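/- For a group $G$ let $G^{(0)}=G$, $G^{(k+1)}=[G^{(k)},G^{(k)}]$ be its derived series, and let $G^{(k)}_H$ be its torsion-free derived series: $G^{(0)}_H=G$, and $G^{(k+1)}_H$ is the inverse image in $G^{(k)}_H$ of the submodule of $\mathbb{Z}[G/G^{(k)}_H]$-torsion elements of the right $\mathbb{Z}[G/G^{(k)}_H]$-module $G^{(k)}_H/[G^{(k)}_H,G^{(k)}_H]$ with action $[x]g=[g^{-1}xg]$, where $[x]$ is torsion if $[x]\gamma=0$ for some nonzero $\gamma\in\mathbb{Z}[G/G^{(k)}_H]$. For a normal subgroup $N$ of $G$ let $\Phi^N(G)$ be the image of the inclusion-induced map $H_2(N;\mathbb{Z})\to H_2(G;\mathbb{Z})$; equivalently, the set of classes of $N$-surfaces of $G$, i.e. of maps $f:\Sigma\to K(G,1)$ of closed oriented surfaces with $f_*(\pi_1(\Sigma))\subset N$. We say that $H_2(G;\mathbb{Q})$ is spanned by $N$-surfaces if it is spanned as a $\mathbb{Q}$-vector space by the image of $\Phi^N(G)$ under $H_2(G;\mathbb{Z})\to H_2(G;\mathbb{Q})$. A group is finitely related if it has a presentation with finitely many relations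 and a possibly infinite set of generators. **Corollary.** Let $F$ be a free group (of arbitrary rank), $B$ a finitely related group, $\phi:F\to B$ a homomorphism inducing a monomorphism $H_1(F;\mathbb{Q})\to H_1(B;\mathbb{Q})$, and $n\ge 0$ an integer. Suppose that $H_2(B;\mathbb{Q})$ is spanned by $B^{(n)}$-surfaces, or more generally by $B^{(n)}_H$-surfaces. Then for every integer $m$ with $0\le m\le n+1$, and in particular for $m=n+1$, the homomorphism $F/F^{(m)}\to B/B^{(m)}$ induced by $\phi$ is injective. -/

import Mathlib

universe u

noncomputable section

namespace TorsionFreeDwyer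

/-! ### Homology of groups with trivial coefficients -/

/-- The coefficient ring `ℤ`, in the universe of the groups under consideration. -/
abbrev IntCoeff : Type u := ULift.{u} ℤ

/-- The coefficient field `ℚ`, in the universe of the groups under consideration. -/
abbrev RatCoeff : Type u := ULift.{u} ℚ

/-- The inclusion `ℤ → ℚ`. -/
def intToRat : IntCoeff.{u} →+* RatCoeff.{u} :=
  ((ULift.ringEquiv (R := ℚ)).symm.toRingHom.comp (Int.castRingHom ℚ)).comp
    (ULift.ringEquiv (R := ℤ)).toRingHom

/-- `Hₙ(G; R)`, the homology of the group `G` with coefficients in the trivial module `R`. -/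
abbrev trivialHomology (R G : Type u) [CommRing R] [Group G] (n : ℕ) : ModuleCat.{u} R :=
  groupHomology (Rep.trivial R G R) n

/-- The map `Hₙ(G; R) → Hₙ(K; R)` induced by a group homomorphism `f : G → K`. -/
def trivialHomologyMap (R : Type u) [CommRing R] {G K : Type u} [Group G] [Group K]
    (f : G →* K) (n : ℕ) : trivialHomology R G n →ₗ[R] trivialHomology R K n :=
  (groupHomology.map (A := Rep.trivial R G R) (B := Rep.trivial R K R) f
    (Rep.ofHom ⟨LinearMap.id, fun _ => rfl⟩) n).hom

section CoefficientChange

variable {R S : Type u} [CommRing R] [CommRing S] (c : R →+* S) (G : Type u) [Group G]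

/-- A ring homomorphism `c : R → S` applied to the coefficients of a chain. -/
def chainCoeffMap (X : Type u) : (X →₀ R) →+ (X →₀ S) :=
  Finsupp.mapRange.addMonoidHom c.toAddMonoidHom

theorem chainCoeffMap_single (X : Type u) (x : X) (r : R) :
    chainCoeffMap c X (Finsupp.single x r) = Finsupp.single x (c r) :=
  Finsupp.mapRange_single (hf := map_zero c)

theorem chainCoeffMap_d₂₁ (x : G × G →₀ R) :
    (groupHomology.d₂₁ (Rep.trivial S G S)).hom (chainCoeffMap c (G × G) x) =
      chainCoeffMap c G ((groupHomology.d₂₁ (Rep.trivial R G R)).hom x) := by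
  induction x using Finsupp.induction_linear with
  | zero => simp
  | add f g hf hg => simp only [map_add, hf, hg]
  | single g r =>
    rw [chainCoeffMap_single, groupHomology.d₂₁_single (A := Rep.trivial R G R),
      groupHomology.d₂₁_single (A := Rep.trivial S G S)]
    simp only [Representation.trivial_apply]
    simp only [map_add, map_sub, chainCoeffMap_single]

theorem chainCoeffMap_d₃₂ (x : G × G × G →₀ R) :
    (groupHomology.d₃₂ (Rep.trivial S G S)).hom (chainCoeffMap c (G × G × G) x) =
      chainCoeffMap c (G × G) ((groupHomology.d₃₂ (Rep.trivial R G R)).hom x) := by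
  induction x using Finsupp.induction_linear with
  | zero => simp
  | add f g hf hg => simp only [map_add, hf, hg]
  | single g r =>
    rw [chainCoeffMap_single, groupHomology.d₃₂_single (A := Rep.trivial R G R),
      groupHomology.d₃₂_single (A := Rep.trivial S G S)]
    simp only [Representation.trivial_apply]
    simp only [map_add, map_sub, chainCoeffMap_single]

/-- Change of coefficients on 2-cycles. -/
def cycles₂CoeffMap : groupHomology.cycles₂ (Rep.trivial R G R) →+
    groupHomology.cycles₂ (Rep.trivial S G S) where
  toFun z := ⟨chainCoeffMap c (G × G) z.1, by
    have hz := z.2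
    simp only [groupHomology.cycles₂, LinearMap.mem_ker] at hz ⊢
    rw [chainCoeffMap_d₂₁, hz, map_zero]⟩
  map_zero' := Subtype.ext (map_zero _)
  map_add' a b := Subtype.ext (map_add _ _ _)

/-- Change of coefficients `H₂(G; R) → H₂(G; S)`: the unique additive map sending the class of a
cycle `z` to the class of the cycle obtained by applying `c` to the coefficients of `z`. -/
def H₂CoeffMap : trivialHomology R G 2 →+ trivialHomology S G 2 :=
  (groupHomology.H2π (Rep.trivial R G R)).hom.toAddMonoidHom.liftOfSurjective
    ((ModuleCat.epi_iff_surjective _).1 inferInstance)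
    ⟨(groupHomology.H2π (Rep.trivial S G S)).hom.toAddMonoidHom.comp (cycles₂CoeffMap c G), by
      intro z hz
      obtain ⟨y, hy⟩ := (groupHomology.H2π_eq_zero_iff (A := Rep.trivial R G R) z).1 hz
      refine (groupHomology.H2π_eq_zero_iff (A := Rep.trivial S G S) _).2 ?_
      refine ⟨chainCoeffMap c (G × G × G) y, ?_⟩
      rw [chainCoeffMap_d₃₂, hy]
      rfl⟩

theorem H₂CoeffMap_π (z : groupHomology.cycles₂ (Rep.trivial R G R)) :
    H₂CoeffMap c G ((groupHomology.H2π (Rep.trivial R G R)).hom z) =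
      (groupHomology.H2π (Rep.trivial S G S)).hom (cycles₂CoeffMap c G z) :=
  AddMonoidHom.liftOfRightInverse_comp_apply _ _ _ _ z

end CoefficientChange

/-- `Φ^N(G)`: the image of `H₂(N; ℤ) → H₂(G; ℤ)`, that is, the set of classes of `N`-surfaces
of `G`. -/
def surfaceClasses {G : Type u} [Group G] (N : Subgroup G) :
    Submodule IntCoeff.{u} (trivialHomology IntCoeff.{u} G 2) :=
  LinearMap.range (trivialHomologyMap IntCoeff.{u} N.subtype 2)

/-- `H₂(G; ℚ)` is spanned, as a rational vector space, by the images of the classes of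
`N`-surfaces of `G` under `H₂(G; ℤ) → H₂(G; ℚ)`. -/
def H₂SpannedBySurfaces {G : Type u} [Group G] (N : Subgroup G) : Prop :=
  Submodule.span RatCoeff.{u}
    (H₂CoeffMap intToRat.{u} G '' (surfaceClasses N : Set (trivialHomology IntCoeff.{u} G 2))) = ⊤

/-! ### The torsion-free derived series -/

section TorsionFreeDerived

variable {G : Type u} [Group G] (N : Subgroup G) [N.Normal]

/-- The right conjugation action `[x] ↦ [g⁻¹ x g]` of `g : G` on `N / [N, N]`, written additively,
as a homomorphism from `G` to the opposite of the endomorphism ring. -/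
def conjRight : G →* (AddMonoid.End (Additive (Abelianization N)))ᵐᵒᵖ where
  toFun g := MulOpposite.op
    (MonoidHom.toAdditive (Abelianization.map (MulAut.conjNormal (H := N) g⁻¹).toMonoidHom))
  map_one' := by
    apply MulOpposite.unop_injective
    ext x
    induction x using Additive.rec with | ofMul x =>
    obtain ⟨x, rfl⟩ := QuotientGroup.mk_surjective x
    change Additive.ofMul (Abelianization.of _) = Additive.ofMul (Abelianization.of _)
    congr 2
    ext
    simp
  map_mul' g h := by
    apply MulOpposite.unop_injective
    ext x
    induction x using Additive.rec with | ofMul x =>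
    obtain ⟨x, rfl⟩ := QuotientGroup.mk_surjective x
    change Additive.ofMul (Abelianization.of _) = Additive.ofMul (Abelianization.of _)
    congr 2
    ext
    simp [mul_assoc]

theorem conjRight_of (g : G) (x : N) :
    (conjRight N g).unop (Additive.ofMul (Abelianization.of x)) =
      Additive.ofMul (Abelianization.of (MulAut.conjNormal g⁻¹ x)) := rfl

/-- The right conjugation action descends to `G / N`. -/
def conjRightQuotient : G ⧸ N →* (AddMonoid.End (Additive (Abelianization N)))ᵐᵒᵖ :=
  QuotientGroup.lift N (conjRight N) (by
    intro g hg
    apply MulOpposite.unop_injective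
    ext x
    induction x using Additive.rec with | ofMul x =>
    obtain ⟨x, rfl⟩ := QuotientGroup.mk_surjective x
    change Additive.ofMul (Abelianization.of (MulAut.conjNormal g⁻¹ x)) =
      Additive.ofMul (Abelianization.of x)
    have h : MulAut.conjNormal g⁻¹ x = (⟨g, hg⟩ : N)⁻¹ * x * ⟨g, hg⟩ := by
      ext
      simp
    rw [h, map_mul Abelianization.of, map_mul Abelianization.of, map_inv, mul_comm,
      mul_inv_cancel_left])

/-- The right `ℤ[G / N]`-module structure on `N / [N, N]`: `moduleAction N γ v` is `v γ`. -/
def moduleAction (γ : MonoidAlgebra ℤ (G ⧸ N)) :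
    Additive (Abelianization N) →+ Additive (Abelianization N) :=
  (MonoidAlgebra.lift ℤ (AddMonoid.End (Additive (Abelianization N)))ᵐᵒᵖ (G ⧸ N)
    (conjRightQuotient N) γ).unop

theorem moduleAction_of (g : G) (x : N) :
    moduleAction N (MonoidAlgebra.of ℤ (G ⧸ N) (g : G ⧸ N))
      (Additive.ofMul (Abelianization.of x)) =
      Additive.ofMul (Abelianization.of (MulAut.conjNormal g⁻¹ x)) := by
  rw [moduleAction, MonoidAlgebra.lift_of]
  rfl

theorem moduleAction_mul (γ δ : MonoidAlgebra ℤ (G ⧸ N)) (v : Additive (Abelianization N)) :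
    moduleAction N (γ * δ) v = moduleAction N δ (moduleAction N γ v) := by
  rw [moduleAction, map_mul]
  rfl

/-- The elements of `N` whose class in `N / [N, N]` is `ℤ[G / N]`-torsion. -/
def torsionPreimage : Set G :=
  {x | ∃ hx : x ∈ N, ∃ γ : MonoidAlgebra ℤ (G ⧸ N), γ ≠ 0 ∧
    moduleAction N γ (Additive.ofMul (Abelianization.of ⟨x, hx⟩)) = 0}

/-- The step of the torsion-free derived series: the inverse image in `N` of the `ℤ[G / N]`-torsion
submodule of `N / [N, N]`. The torsion elements form a submodule for each term `N` of the series,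
because `ℤ[G / N]` is then an Ore domain; for such `N`, taking the generated subgroup adds
nothing. -/
def torsionStep : Subgroup G := Subgroup.closure (torsionPreimage N)

theorem torsionPreimage_conj {x : G} (hx : x ∈ torsionPreimage N) (g : G) :
    g * x * g⁻¹ ∈ torsionPreimage N := by
  obtain ⟨hxN, γ, hγ, h⟩ := hx
  refine ⟨Subgroup.Normal.conj_mem inferInstance x hxN g,
    MonoidAlgebra.of ℤ (G ⧸ N) (g : G ⧸ N) * γ, ?_, ?_⟩
  · intro h0
    apply hγ
    have h1 := congrArg (fun t => MonoidAlgebra.of ℤ (G ⧸ N) ((g : G ⧸ N)⁻¹) * t) h0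
    simpa only [← mul_assoc, ← map_mul, inv_mul_cancel, map_one, one_mul, mul_zero] using h1
  · rw [moduleAction_mul, moduleAction_of]
    convert h using 5
    simp [mul_assoc]

instance torsionStep_normal : (torsionStep N).Normal where
  conj_mem x hx g := by
    have h : torsionStep N ≤ (torsionStep N).comap (MulAut.conj g).toMonoidHom := by
      refine (Subgroup.closure_le _).2 fun y hy => ?_
      exact Subgroup.subset_closure (torsionPreimage_conj N hy g)
    exact h hx

end TorsionFreeDerived

/-- The torsion-free derived series, together with the normality of its terms. -/
def torsionFreeDerivedAux (G : Type u) [Group G] : ℕ → {N : Subgroup G // N.Normal}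
  | 0 => ⟨⊤, inferInstance⟩
  | n + 1 =>
    haveI := (torsionFreeDerivedAux G n).2
    ⟨torsionStep (torsionFreeDerivedAux G n).1, inferInstance⟩

/-- The term `G_H^{(n)}` of the torsion-free derived series of `G`. -/
def torsionFreeDerivedSeries (G : Type u) [Group G] (n : ℕ) : Subgroup G :=
  (torsionFreeDerivedAux G n).1

/-- `G` is finitely related: it has a presentation with finitely many relations (and an arbitrary,
possibly infinite, set of generators). -/
def FinitelyRelated (G : Type u) [Group G] : Prop :=
  ∃ (X : Type u) (rels : Set (FreeGroup X)), rels.Finite ∧ Nonempty (PresentedGroup rels ≃* G)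

/-- The map `G / G^{(m)} → K / K^{(m)}` induced by a homomorphism `f : G → K`. -/
def derivedQuotientMap {G K : Type u} [Group G] [Group K] (f : G →* K) (m : ℕ) :
    G ⧸ derivedSeries G m →* K ⧸ derivedSeries K m :=
  QuotientGroup.map (derivedSeries G m) (derivedSeries K m) f
    (Subgroup.map_le_iff_le_comap.1 (map_derivedSeries_le_derivedSeries f m))

end TorsionFreeDwyer

end

/-!
The theorem follows from the stronger inclusion `φ⁻¹(B_H^{(m)}) ≤ F^{(m)}` for `m ≤ n + 1`
(`comap_torsionFreeDerivedSeries_le`), which is proved by induction on `m`.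

For the inductive step put `N = B_H^{(m)}` and `Γ = B / N`, and let `k = ℚ`. A finite family of
relators for `B` has a matrix `∂` of Fox derivatives over `k[Γ]` (`relatorMap`), and the map `φ`,
lifted to the free group on the generators of `B`, gives a homomorphism `ψ` from the free
`k[Γ]`-module on a basis of `F` to the target of `∂`. If `φ f` is torsion in `N / [N, N]`, then a
non-zero multiple of `ψ (D f)` is in the image of `∂`, where `D f` is the vector of Fox derivatives
of `f` (`invol_smul_foxDerivation_mem_range`). Once `ψ` is known to be injective modulo the image
of `∂`, the vector `D f` vanishes, and by Magnus' theorem `f` lies in the commutator subgroup of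
`φ⁻¹(N)` (`mem_commutator_ker_of_foxDerivation`), which is contained in `F^{(m + 1)}` by induction.

The injectivity of `ψ` modulo the image of `∂` is derived from statements over `k`, obtained by
augmentation (`eq_zero_of_augVec`).

* Over `k`, the map `ψ` is injective modulo the image of `∂`, as `F → B` is injective on
  `H₁(–; ℚ)` (`augVec_eq_zero_of_injective`).
* The kernel of the augmented matrix represents `H₂` of the presentation complex. By the
  assumption on `H₂(B; ℚ)`, its elements are augmentations of elements of the kernel of `∂`
  (`exists_augVec_eq_of_surfaces`). Indeed, an obstruction to lifting is a linear map on
  `H₂(B; ℚ)`, and it vanishes on `N`-surfaces because these lift to the cover of `B` with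
  group `Γ`.
* Vectors over `k[Γ]` are linearly independent if their augmentations are so. This passes from
  `G / N` to `G / N'`, for `N'` the next term of the torsion-free derived series, because `N / N'`
  is torsion-free abelian (`linearIndependent_of_mapVec`).
* As there are finitely many relators, ranks of free `k[Γ]`-modules can be compared: `k[Γ]` has
  no zero divisors because `Γ` has unique products (`uniqueProds_of_extension`), and it satisfies
  the strong rank condition because `Γ` is solvable (`strongRankCondition_of_isSolvable`). The
  latter is shown by counting on Følner sets in abelian groups.
-/

namespace TorsionFreeDwyer

/-! ### Unique products -/

/-- Unique products pass to extensions: among the pairs over a unique product in the quotient, the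
factors are translates of elements of the kernel. -/
theorem uniqueProds_of_extension {G Q : Type*} [Group G] [Group Q] (π : G →* Q)
    [UniqueProds Q] [UniqueProds π.ker] : UniqueProds G where
  uniqueMul_of_nonempty {A B} hA hB := by
    classical
    obtain ⟨a', ha', b', hb', hu⟩ :=
      UniqueProds.uniqueMul_of_nonempty (hA.image π) (hB.image π)
    obtain ⟨a, ha, rfl⟩ := Finset.mem_image.1 ha'
    obtain ⟨b, hb, rfl⟩ := Finset.mem_image.1 hb'
    -- translate the parts of `A` and `B` over the unique product into the kernel
    have hiA : Function.Injective fun n : π.ker => a * (n : G) := fun x y h =>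
      Subtype.ext (mul_left_cancel h)
    have hiB : Function.Injective fun n : π.ker => (n : G) * b := fun x y h =>
      Subtype.ext (mul_right_cancel h)
    obtain ⟨n, hn, m, hm, hnm⟩ := UniqueProds.uniqueMul_of_nonempty
      (A := A.preimage _ hiA.injOn) (B := B.preimage _ hiB.injOn)
      ⟨1, by simpa using ha⟩ ⟨1, by simpa using hb⟩
    rw [Finset.mem_preimage] at hn hm
    refine ⟨_, hn, _, hm, fun x y hx hy hxy => ?_⟩
    have hπ : π x * π y = π a * π b := by
      rw [← map_mul, hxy]
      simp [π.mem_ker.1 n.2, π.mem_ker.1 m.2]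
    obtain ⟨h1, h2⟩ := hu (Finset.mem_image_of_mem _ hx) (Finset.mem_image_of_mem _ hy) hπ
    have hx' : a⁻¹ * x ∈ π.ker := by simp [MonoidHom.mem_ker, h1]
    have hy' : y * b⁻¹ ∈ π.ker := by simp [MonoidHom.mem_ker, h2]
    obtain ⟨h3, h4⟩ := hnm (a := ⟨_, hx'⟩) (b := ⟨_, hy'⟩) (by simpa using hx) (by simpa using hy)
      (by
        ext
        simp only [Subgroup.coe_mul]
        calc a⁻¹ * x * (y * b⁻¹) = a⁻¹ * (x * y) * b⁻¹ := by group
          _ = n * m := by rw [hxy]; group)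
    rw [← h3, ← h4]
    simp

/-- A torsion-free abelian group embeds into a rational vector space. -/
theorem uniqueProds_of_isMulTorsionFree (A : Type*) [CommGroup A] [IsMulTorsionFree A] :
    UniqueProds A := by
  have h : UniqueProds (Multiplicative (DivisibleHull (Additive A))) := inferInstance
  exact UniqueProds.of_injective_mulHom
    (G := Multiplicative (DivisibleHull (Additive A)))
    { toFun := fun a => Multiplicative.ofAdd
        (DivisibleHull.coeAddMonoidHom (M := Additive A) (Additive.ofMul a))
      map_mul' := fun a b => map_add (DivisibleHull.coeAddMonoidHom (M := Additive A)) _ _ }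
    (fun x y hxy => DivisibleHull.coe_injective (M := Additive A) hxy) h

/-! ### Følner sets in abelian groups -/

open scoped Pointwise in
/-- The powers of a finite set in an abelian group grow polynomially: an element of `E ^ t` is
determined by the multiplicities of its factors. -/
theorem card_pow_le_of_comm {Q : Type*} [CommGroup Q] [DecidableEq Q] (E : Finset Q) (t : ℕ) :
    (E ^ t).card ≤ (t + 1) ^ E.card := by
  classical
  have h : ∀ t : ℕ, ∀ x ∈ E ^ t, ∃ f : E → ℕ, (∀ e, f e ≤ t) ∧ x = ∏ e : E, (e : Q) ^ f e := by
    intro t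
    induction t with
    | zero =>
      intro x hx
      rw [pow_zero, Finset.mem_one] at hx
      exact ⟨0, by simp, by simp [hx]⟩
    | succ t ih =>
      intro x hx
      rw [pow_succ] at hx
      obtain ⟨y, hy, e, he, rfl⟩ := Finset.mem_mul.1 hx
      obtain ⟨f, hf, rfl⟩ := ih y hy
      refine ⟨f + Pi.single ⟨e, he⟩ 1, fun e' => ?_, ?_⟩
      · refine (add_le_add (hf e') ?_ : _ ≤ t + 1)
        by_cases h : e' = ⟨e, he⟩
        · subst h
          simp
        · simp [h]
      · simp only [Pi.add_apply, pow_add, Finset.prod_mul_distrib]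
        congr 1
        rw [Finset.prod_eq_single ⟨e, he⟩] <;> simp +contextual
  calc (E ^ t).card
      ≤ ((Fintype.piFinset fun _ : E => Finset.range (t + 1)).image
          fun f => ∏ e : E, (e : Q) ^ f e).card := by
        refine Finset.card_le_card fun x hx => ?_
        obtain ⟨f, hf, rfl⟩ := h t x hx
        exact Finset.mem_image_of_mem _ (Fintype.mem_piFinset.2 fun e =>
          Finset.mem_range.2 (Nat.lt_succ_of_le (hf e)))
    _ ≤ _ := Finset.card_image_le
    _ = _ := by simp

open scoped Pointwise in
/-- Some power of `E` is almost invariant under multiplication by `E`, because the powers of `E`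
grow polynomially. -/
theorem exists_card_mul_lt {Q : Type*} [CommGroup Q] [DecidableEq Q] (E : Finset Q) {m n : ℕ}
    (hmn : m < n) : ∃ S : Finset Q, (S * E).card * m < S.card * n := by
  by_contra! H
  have hpow : ∀ t : ℕ, n ^ t ≤ (E ^ t).card * m ^ t := by
    intro t
    induction t with
    | zero => simp
    | succ t ih =>
      calc n ^ (t + 1) = n ^ t * n := pow_succ _ _
        _ ≤ (E ^ t).card * m ^ t * n := Nat.mul_le_mul_right _ ih
        _ = (E ^ t).card * n * m ^ t := by ring
        _ ≤ (E ^ t * E).card * m * m ^ t := Nat.mul_le_mul_right _ (H _)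
        _ = (E ^ (t + 1)).card * m ^ (t + 1) := by rw [pow_succ E, pow_succ m]; ring
  rcases Nat.eq_zero_or_pos m with rfl | hm
  · have := hpow 1
    simp at this
    omega
  have hr : |(m : ℝ) / n| < 1 := by
    rw [abs_of_nonneg (by positivity), div_lt_one (by exact_mod_cast hm.trans hmn)]
    exact_mod_cast hmn
  have hlim := (tendsto_pow_const_mul_const_pow_of_abs_lt_one E.card hr).comp
    (Filter.tendsto_add_atTop_nat 1)
  have hsmall : ∀ᶠ t : ℕ in Filter.atTop,
      ((t + 1 : ℕ) : ℝ) ^ E.card * ((m : ℝ) / n) ^ (t + 1) < (m : ℝ) / n :=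
    hlim.eventually_lt_const (by have := hm.trans hmn; positivity)
  obtain ⟨t, ht⟩ := hsmall.exists
  have hn : (0 : ℝ) < n := by exact_mod_cast hm.trans hmn
  have hm' : (0 : ℝ) < m := by exact_mod_cast hm
  have h1 : ((n : ℝ)) ^ t ≤ ((t + 1 : ℕ) : ℝ) ^ E.card * (m : ℝ) ^ t := by
    exact_mod_cast (hpow t).trans (Nat.mul_le_mul_right _ (card_pow_le_of_comm E t))
  rw [pow_succ, ← mul_assoc, div_pow] at ht
  have h2 : ((t + 1 : ℕ) : ℝ) ^ E.card * ((m : ℝ) ^ t / n ^ t) < 1 := by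
    by_contra! h
    exact absurd ht (not_lt.2 (le_mul_of_one_le_left (by positivity) h))
  rw [← mul_div_assoc, div_lt_one (by positivity)] at h2
  exact absurd h1 (not_le.2 h2)

/-! ### Group algebras over the group algebra of a normal subgroup -/

section Cosets

variable {k : Type*} [CommRing k] {G Q : Type*} [Group G] [Group Q] (π : G →* Q)

variable (k) in
/-- The inclusion `k[ker π] → k[G]`. -/
noncomputable def kerIncl : MonoidAlgebra k π.ker →+* MonoidAlgebra k G :=
  MonoidAlgebra.mapDomainRingHom k π.ker.subtype

/-- The part of an element of `k[G]` on the coset `(ker π) g`, translated into `k[ker π]`. -/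
noncomputable def cosetCoeff (g : G) : MonoidAlgebra k G →+ MonoidAlgebra k π.ker where
  toFun a := .ofCoeff (a.coeff.comapDomain (fun n : π.ker => (n : G) * g)
    (fun x _ y _ h => Subtype.ext (mul_right_cancel h)))
  map_zero' := by ext; simp
  map_add' a b := by
    ext
    rfl

@[simp]
theorem coeff_cosetCoeff (g : G) (a : MonoidAlgebra k G) (n : π.ker) :
    (cosetCoeff π g a).coeff n = a.coeff (n * g) := rfl

theorem kerIncl_single (n : π.ker) (c : k) :
    kerIncl k π (MonoidAlgebra.single n c) = MonoidAlgebra.single (n : G) c := by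
  simp [kerIncl]

theorem cosetCoeff_kerIncl_mul (g : G) (r : MonoidAlgebra k π.ker) (a : MonoidAlgebra k G) :
    cosetCoeff π g (kerIncl k π r * a) = r * cosetCoeff π g a := by
  induction r using MonoidAlgebra.induction_linear with
  | zero => simp
  | add x y hx hy => simp only [map_add, add_mul, hx, hy]
  | single n c =>
    ext m
    simp [kerIncl_single, mul_assoc]

theorem cosetCoeff_single_self (g : G) :
    cosetCoeff π g (MonoidAlgebra.single g (1 : k)) = 1 := by
  classical
  ext n
  rw [coeff_cosetCoeff, MonoidAlgebra.one_def, MonoidAlgebra.coeff_single,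
    MonoidAlgebra.coeff_single, Finsupp.single_apply, Finsupp.single_apply]
  exact if_congr (by rw [right_eq_mul, OneMemClass.coe_eq_one, eq_comm]) rfl rfl

theorem cosetCoeff_eq_zero_of_support (g : G) (a : MonoidAlgebra k G)
    (h : ∀ x ∈ a.coeff.support, π x ≠ π g) : cosetCoeff π g a = 0 := by
  ext n
  rw [coeff_cosetCoeff]
  by_contra hn
  exact h _ (Finsupp.mem_support_iff.2 hn) (by simp [π.mem_ker.1 n.2])

theorem cosetCoeff_single_of_ne {g h : G} (hgh : π h ≠ π g) :
    cosetCoeff π g (MonoidAlgebra.single h (1 : k)) = 0 := by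
  refine cosetCoeff_eq_zero_of_support π _ _ fun x hx => ?_
  rw [Finset.mem_singleton.1 (Finsupp.support_single_subset hx)]
  exact hgh

variable {π} {s : Q → G} (hs : ∀ q, π (s q) = q)
include hs

theorem eq_zero_of_cosetCoeff {a : MonoidAlgebra k G} (h : ∀ q, cosetCoeff π (s q) a = 0) :
    a = 0 := by
  ext g
  have hg : g * (s (π g))⁻¹ ∈ π.ker := by simp [MonoidHom.mem_ker, hs]
  have := congrArg (fun r => r.coeff ⟨_, hg⟩) (h (π g))
  simpa using this

theorem cosetCoeff_sum (T : Finset Q) (c : Q → MonoidAlgebra k π.ker) (q : Q) [DecidableEq Q] :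
    cosetCoeff π (s q) (∑ t ∈ T, kerIncl k π (c t) * MonoidAlgebra.single (s t) 1) =
      if q ∈ T then c q else 0 := by
  rw [map_sum]
  have : ∀ t, cosetCoeff π (s q) (kerIncl k π (c t) * MonoidAlgebra.single (s t) 1) =
      if t = q then c q else 0 := by
    intro t
    rw [cosetCoeff_kerIncl_mul]
    split_ifs with h
    · rw [h, cosetCoeff_single_self, mul_one]
    · rw [cosetCoeff_single_of_ne π (by rwa [hs, hs]), mul_zero]
  simp [this]

theorem sum_cosetCoeff (a : MonoidAlgebra k G) (T : Finset Q)
    (hT : ∀ g ∈ a.coeff.support, π g ∈ T) :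
    ∑ t ∈ T, kerIncl k π (cosetCoeff π (s t) a) * MonoidAlgebra.single (s t) 1 = a := by
  classical
  refine sub_eq_zero.1 (eq_zero_of_cosetCoeff hs fun q => ?_)
  rw [map_sub, cosetCoeff_sum hs]
  split_ifs with h
  · exact sub_self _
  · rw [zero_sub, neg_eq_zero]
    refine cosetCoeff_eq_zero_of_support π _ _ fun x hx hxq => h ?_
    rw [hs] at hxq
    exact hxq ▸ hT x hx

end Cosets

/-! ### The strong rank condition for group algebras of solvable groups -/

open scoped Pointwise in
/-- An injection `k[G]ⁿ → k[G]ᵐ` with `m < n` would restrict, on vectors supported over a Følner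
set `S` of the quotient, to an injection of free `k[ker π]`-modules of decreasing rank. -/
theorem strongRankCondition_of_extension {k : Type*} [CommRing k] {G Q : Type*} [Group G]
    [CommGroup Q] (π : G →* Q) (hπ : Function.Surjective π)
    [StrongRankCondition (MonoidAlgebra k π.ker)] : StrongRankCondition (MonoidAlgebra k G) where
  le_of_fin_injective {n m} f hf := by
    classical
    by_contra! hmn
    -- `f` maps vectors supported over `S` to vectors supported over `S * E`
    obtain ⟨s, hs⟩ := hπ.hasRightInverse
    set E : Finset Q := Finset.univ.biUnion fun j : Fin n => Finset.univ.biUnion fun i : Fin m =>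
      ((f (Pi.single j 1) i).coeff.support.image π) with hE
    obtain ⟨S, hS⟩ := exists_card_mul_lt E hmn
    let lift : (Fin n × S → MonoidAlgebra k π.ker) → (Fin n → MonoidAlgebra k G) :=
      fun c j => ∑ t : S, kerIncl k π (c (j, t)) * MonoidAlgebra.single (s t) 1
    have hlift_smul : ∀ (r : MonoidAlgebra k π.ker) c,
        lift (r • c) = kerIncl k π r • lift c := by
      intro r c
      ext1 j
      simp [lift, Finset.mul_sum, mul_assoc]
    have hlift_add : ∀ c d, lift (c + d) = lift c + lift d := by
      intro c d
      ext1 j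
      simp [lift, add_mul, Finset.sum_add_distrib]
    let g : (Fin n × S → MonoidAlgebra k π.ker) →ₗ[MonoidAlgebra k π.ker]
        (Fin m × (S * E : Finset Q) → MonoidAlgebra k π.ker) :=
      { toFun := fun c p => cosetCoeff π (s p.2) (f (lift c) p.1)
        map_add' := fun c d => by
          ext1 p
          simp [hlift_add]
        map_smul' := fun r c => by
          ext1 p
          simp [hlift_smul, cosetCoeff_kerIncl_mul] }
    have hfl : ∀ c i, f (lift c) i = ∑ j, ∑ t : S,
        kerIncl k π (c (j, t)) * (MonoidAlgebra.single (s t) 1 * f (Pi.single j 1) i) := by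
      intro c i
      conv_lhs => rw [pi_eq_sum_univ' (lift c)]
      simp [lift, Finset.sum_mul, mul_assoc, Finset.sum_apply]
    have hg : Function.Injective g := by
      rw [← LinearMap.ker_eq_bot, LinearMap.ker_eq_bot']
      intro c hc
      have hzero : f (lift c) = 0 := by
        ext1 i
        refine eq_zero_of_cosetCoeff hs fun q => ?_
        by_cases hq : q ∈ S * E
        · exact congrFun hc (i, ⟨q, hq⟩)
        · rw [hfl, map_sum]
          refine Finset.sum_eq_zero fun j _ => ?_
          rw [map_sum]
          refine Finset.sum_eq_zero fun t _ => ?_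
          rw [cosetCoeff_kerIncl_mul]
          convert mul_zero _
          refine cosetCoeff_eq_zero_of_support π _ _ fun x hx hxq => hq ?_
          rw [Finsupp.mem_support_iff, MonoidAlgebra.coeff_single_mul_apply, one_mul] at hx
          rw [hs] at hxq
          have : π ((s t)⁻¹ * x) ∈ E := by
            rw [hE]
            simp only [Finset.mem_biUnion, Finset.mem_univ, true_and]
            exact ⟨j, i, Finset.mem_image_of_mem _ (Finsupp.mem_support_iff.2 hx)⟩
          rw [map_mul, map_inv, hs, hxq] at this
          exact Finset.mem_mul.2 ⟨t, t.2, _, this, by simp⟩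
      have hl : lift c = 0 := hf (by rw [hzero, map_zero])
      ext1 p
      obtain ⟨j, t⟩ := p
      have h1 := congrArg (cosetCoeff π (s t)) (congrFun hl j)
      let c' : Q → MonoidAlgebra k π.ker := fun q => if h : q ∈ S then c (j, ⟨q, h⟩) else 0
      have h2 : lift c j = ∑ t ∈ S, kerIncl k π (c' t) * MonoidAlgebra.single (s t) 1 := by
        rw [← Finset.sum_coe_sort S]
        exact Finset.sum_congr rfl fun t _ => by simp [c']
      rw [h2, cosetCoeff_sum hs, if_pos t.2] at h1
      simpa [c'] using h1
    have := card_le_of_injective (MonoidAlgebra k π.ker) g hg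
    simp only [Fintype.card_prod, Fintype.card_fin, Fintype.card_coe] at this
    rw [mul_comm, mul_comm m] at this
    omega

theorem strongRankCondition_of_derivedSeries (k : Type*) [CommRing k] [Nontrivial k] (n : ℕ) :
    ∀ (G : Type u) [Group G], derivedSeries G n = ⊥ →
      StrongRankCondition (MonoidAlgebra k G) := by
  induction n with
  | zero =>
    intro G _ h
    have : Subsingleton G := by
      rw [derivedSeries_zero] at h
      exact Subgroup.subsingleton_iff.1 (subsingleton_of_bot_eq_top h.symm)
    have hmul : ∀ a b : MonoidAlgebra k G, a * b = b * a := by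
      let _ : CommGroup G := { ‹Group G› with mul_comm := fun a b => Subsingleton.elim _ _ }
      exact fun a b => mul_comm a b
    let _ : CommRing (MonoidAlgebra k G) :=
      { (inferInstance : Ring (MonoidAlgebra k G)) with mul_comm := hmul }
    exact commRing_strongRankCondition _
  | succ n ih =>
    intro G _ h
    have hker : (Abelianization.of : G →* Abelianization G).ker = derivedSeries G 1 := by
      rw [Abelianization.ker_of, derivedSeries_one]
    have := ih (Abelianization.of : G →* Abelianization G).ker (by
      refine (Subgroup.map_injective (Subgroup.subtype_injective _)) ?_
      rw [Subgroup.map_bot, eq_bot_iff, ← h]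
      have : ∀ j, (derivedSeries (Abelianization.of : G →* Abelianization G).ker j).map
          (Subgroup.subtype _) ≤ derivedSeries G (j + 1) := by
        intro j
        induction j with
        | zero =>
          rw [derivedSeries_zero, ← MonoidHom.range_eq_map, Subgroup.range_subtype, hker]
        | succ j ihj =>
          rw [derivedSeries_succ, Subgroup.map_commutator, derivedSeries_succ G (j + 1)]
          exact Subgroup.commutator_mono ihj ihj
      exact this n)
    exact strongRankCondition_of_extension (Abelianization.of : G →* Abelianization G)
      (QuotientGroup.mk_surjective)

/-- The group algebra of a solvable group satisfies the strong rank condition. -/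
theorem strongRankCondition_of_isSolvable (k : Type*) [CommRing k] [Nontrivial k] (G : Type*)
    [Group G] [h : Group.IsSolvable G] : StrongRankCondition (MonoidAlgebra k G) := by
  obtain ⟨n, hn⟩ := h.solvable
  exact strongRankCondition_of_derivedSeries k n G hn

/-! ### Linear independence modulo the augmentation ideal -/

/-- Vectors over a commutative domain are linearly independent as soon as they are so after
applying a homomorphism to a field: the functionals dual to the images lift, and the matrix of
their values on the vectors has a non-zero determinant, since it reduces to the identity. -/
theorem linearIndependent_of_mapRange {k R ι κ : Type*} [Field k] [CommRing R] [IsDomain R]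
    [Algebra k R] (ε : R →ₐ[k] k) (v : ι → κ →₀ R)
    (h : LinearIndependent k fun i => Finsupp.mapRange.linearMap ε.toLinearMap (v i)) :
    LinearIndependent R v := by
  classical
  rw [linearIndependent_iff']
  intro s c hc i hi
  have hs : LinearIndependent k
      fun i : s => Finsupp.mapRange.linearMap ε.toLinearMap (v i) := h.comp _ Subtype.val_injective
  obtain ⟨ℓ, hℓ⟩ := LinearMap.exists_leftInverse_of_injective
    (Finsupp.linearCombination k fun i : s => Finsupp.mapRange.linearMap ε.toLinearMap (v i))
    (LinearMap.ker_eq_bot.2 hs)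
  have hℓv : ∀ i : s, ℓ (Finsupp.mapRange.linearMap ε.toLinearMap (v i)) = Finsupp.single i 1 := by
    intro i
    have := LinearMap.congr_fun hℓ (Finsupp.single i 1)
    simpa using this
  -- the functionals dual to the reduced vectors, with coefficients lifted to `R`
  let L : s → (κ →₀ R) →ₗ[R] R := fun j =>
    Finsupp.linearCombination R fun y => algebraMap k R (ℓ (Finsupp.single y 1) j)
  have hL : ∀ j x, ε (L j x) = ℓ (Finsupp.mapRange.linearMap ε.toLinearMap x) j := by
    intro j x
    induction x using Finsupp.induction_linear with
    | zero => simp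
    | add x y hx hy => rw [map_add, map_add, hx, hy, map_add, map_add, Finsupp.add_apply]
    | single y r =>
      have : Finsupp.single y (ε r) = ε r • Finsupp.single y (1 : k) := by simp
      simp only [L, Finsupp.linearCombination_single, smul_eq_mul, map_mul, AlgHom.commutes,
        Finsupp.mapRange.linearMap_apply, Finsupp.mapRange_single, AlgHom.toLinearMap_apply]
      rw [this, map_smul, Finsupp.smul_apply, smul_eq_mul]
      simp
  let M : Matrix s s R := fun j i => L j (v i)
  have hM : M.det ≠ 0 := by
    intro h0
    have h1 : ε.toRingHom.mapMatrix M = 1 := by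
      ext j i
      rw [RingHom.mapMatrix_apply, Matrix.map_apply]
      change ε (L j (v i)) = _
      rw [hL, hℓv, Matrix.one_apply, Finsupp.single_apply]
      simp [eq_comm]
    have h2 := RingHom.map_det ε.toRingHom M
    rw [h0, h1, map_zero, Matrix.det_one] at h2
    exact zero_ne_one h2
  have hv : M.mulVec (fun i : s => c i) = 0 := by
    ext1 j
    have := congrArg (L j) hc
    rw [map_sum, map_zero, ← Finset.sum_coe_sort] at this
    simpa [Matrix.mulVec, dotProduct, M, mul_comm] using this
  exact congrFun (Matrix.eq_zero_of_mulVec_eq_zero hM hv) ⟨i, hi⟩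

variable (k : Type*) [Field k]

/-- The augmentation `k[G] → k`. -/
noncomputable def aug (G : Type*) [Group G] : MonoidAlgebra k G →ₐ[k] k :=
  MonoidAlgebra.lift k k G 1

@[simp]
theorem aug_single {G : Type*} [Group G] (g : G) (c : k) :
    aug k G (MonoidAlgebra.single g c) = c := by
  simp [aug]

/-- The augmentation on vectors with entries in `k[G]`. -/
noncomputable def augVec (G S : Type*) [Group G] : (S →₀ MonoidAlgebra k G) →ₗ[k] (S →₀ k) :=
  Finsupp.mapRange.linearMap (aug k G).toLinearMap

variable {k}

@[simp]
theorem augVec_apply {G S : Type*} [Group G] (x : S →₀ MonoidAlgebra k G) (y : S) :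
    augVec k G S x y = aug k G (x y) := rfl

theorem augVec_smul {G S : Type*} [Group G] (a : MonoidAlgebra k G) (x : S →₀ MonoidAlgebra k G) :
    augVec k G S (a • x) = aug k G a • augVec k G S x := by
  ext
  simp

@[simp]
theorem augVec_single {G S : Type*} [Group G] (s : S) (a : MonoidAlgebra k G) :
    augVec k G S (Finsupp.single s a) = Finsupp.single s (aug k G a) := by
  simp [augVec]

/-- The map induced on vectors over group algebras by a group homomorphism. -/
noncomputable def mapVec {G Q : Type*} [Group G] [Group Q] (S : Type*) (π : G →* Q) :
    (S →₀ MonoidAlgebra k G) →+ (S →₀ MonoidAlgebra k Q) :=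
  Finsupp.mapRange.addMonoidHom (MonoidAlgebra.mapDomainRingHom k π).toAddMonoidHom

@[simp]
theorem mapVec_apply {G Q S : Type*} [Group G] [Group Q] (π : G →* Q)
    (x : S →₀ MonoidAlgebra k G) (y : S) :
    mapVec S π x y = MonoidAlgebra.mapDomainRingHom k π (x y) := rfl

theorem aug_cosetCoeff {G Q : Type*} [Group G] [Group Q] (π : G →* Q) (g : G)
    (a : MonoidAlgebra k G) :
    aug k π.ker (cosetCoeff π g a) = (MonoidAlgebra.mapDomainRingHom k π a).coeff (π g) := by
  classical
  induction a using MonoidAlgebra.induction_linear with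
  | zero => simp
  | add x y hx hy => rw [map_add, map_add, hx, hy, map_add]; rfl
  | single h c =>
    rw [MonoidAlgebra.mapDomainRingHom_apply, MonoidAlgebra.mapDomain_single,
      MonoidAlgebra.coeff_single, Finsupp.single_apply]
    split_ifs with hg
    · have hn : h * g⁻¹ ∈ π.ker := by simp [MonoidHom.mem_ker, hg]
      have : MonoidAlgebra.single h c = kerIncl k π (MonoidAlgebra.single ⟨_, hn⟩ c) *
          MonoidAlgebra.single g (1 : k) := by
        simp [kerIncl_single, MonoidAlgebra.single_mul_single]
      rw [this, cosetCoeff_kerIncl_mul, cosetCoeff_single_self, mul_one, aug_single]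
    · rw [cosetCoeff_eq_zero_of_support, map_zero]
      intro x hx
      rw [Finset.mem_singleton.1 (Finsupp.support_single_subset hx)]
      exact hg

/-- Strebel's argument: linear independence over `k[G]` can be checked over `k[Q]` if the kernel of
`G → Q` is torsion-free abelian, as `k[G]` is free over the commutative domain `k[ker π]`. -/
theorem linearIndependent_of_mapVec {G Q : Type*} [Group G] [Group Q] (π : G →* Q)
    (hπ : Function.Surjective π) (hcomm : ∀ a b : π.ker, a * b = b * a) [UniqueProds π.ker]
    {S ι : Type*} (v : ι → S →₀ MonoidAlgebra k G)
    (h : LinearIndependent (MonoidAlgebra k Q) fun i => mapVec S π (v i)) :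
    LinearIndependent (MonoidAlgebra k G) v := by
  classical
  obtain ⟨s, hs⟩ := hπ.hasRightInverse
  let _ : CommGroup π.ker := { (inferInstance : Group π.ker) with mul_comm := hcomm }
  let coords : (S →₀ MonoidAlgebra k G) → (S × Q →₀ MonoidAlgebra k π.ker) := fun x =>
    Finsupp.onFinset
      (x.support.biUnion fun y => (x y).coeff.support.image fun g => (y, π g))
      (fun p => cosetCoeff π (s p.2) (x p.1)) (by
        rintro ⟨y, q⟩ hyq
        by_contra hn
        refine hyq (cosetCoeff_eq_zero_of_support π _ _ fun g hg hgq => hn ?_)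
        refine Finset.mem_biUnion.2 ⟨y, ?_, Finset.mem_image.2 ⟨g, hg, ?_⟩⟩
        · rw [Finsupp.mem_support_iff]
          rintro h0
          simp [h0] at hg
        · rw [hgq, hs])
  have hcoords : ∀ x y q, coords x (y, q) = cosetCoeff π (s q) (x y) := fun _ _ _ => rfl
  -- a basis of `k[G]` over `k[ker π]` times the given family
  let w : ι × Q → (S × Q →₀ MonoidAlgebra k π.ker) := fun p =>
    coords (MonoidAlgebra.single (s p.2) (1 : k) • v p.1)
  have hw : LinearIndependent (MonoidAlgebra k π.ker) w := by
    refine linearIndependent_of_mapRange (aug k π.ker) w ?_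
    have hb : LinearIndependent k fun q : Q => (MonoidAlgebra.single q 1 : MonoidAlgebra k Q) := by
      rw [linearIndependent_iff']
      intro t c hc q hq
      have := congrArg (fun a => a.coeff q) hc
      simpa [Finsupp.single_apply, hq] using this
    have hbv := linearIndependent_smul hb h
    rw [linearIndependent_iff'] at hbv ⊢
    intro t c hc p hp
    have key : ∀ i q y q', aug k π.ker (w (i, q) (y, q')) =
        ((MonoidAlgebra.single q (1 : k) • mapVec S π (v i)) y).coeff q' := by
      intro i q y q'
      rw [hcoords, aug_cosetCoeff, hs, Finsupp.smul_apply, Finsupp.smul_apply, smul_eq_mul,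
        smul_eq_mul, map_mul, MonoidAlgebra.mapDomainRingHom_apply, MonoidAlgebra.mapDomain_single,
        hs, mapVec_apply]
    have := hbv (t.map (Equiv.prodComm ι Q).toEmbedding) (fun p => c p.swap) (by
      rw [Finset.sum_map]
      ext y q'
      have h1 := DFunLike.congr_fun hc (y, q')
      rw [Finsupp.finsetSum_apply] at h1
      simp only [Finsupp.smul_apply, Finsupp.mapRange.linearMap_apply, Finsupp.mapRange_apply,
        AlgHom.toLinearMap_apply, key, Finsupp.coe_zero, Pi.zero_apply] at h1
      rw [Finsupp.finsetSum_apply, MonoidAlgebra.coeff_sum, Finsupp.finsetSum_apply]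
      simpa using h1) p.swap (by simpa using hp)
    simpa using this
  rw [linearIndependent_iff'] at hw ⊢
  intro t c hc i hi
  set T : Finset Q := t.biUnion fun i => (c i).coeff.support.image π with hT
  have hcT : ∀ i ∈ t, ∑ q ∈ T, kerIncl k π (cosetCoeff π (s q) (c i)) *
      MonoidAlgebra.single (s q) 1 = c i := fun i hi =>
    sum_cosetCoeff hs _ _ fun g hg =>
      Finset.mem_biUnion.2 ⟨i, hi, Finset.mem_image_of_mem _ hg⟩
  have h0 := hw (t ×ˢ T) (fun p => cosetCoeff π (s p.2) (c p.1)) (by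
    ext1 ⟨y, q'⟩
    rw [Finset.sum_product, Finsupp.finsetSum_apply, Finsupp.coe_zero, Pi.zero_apply]
    calc _ = ∑ i ∈ t, cosetCoeff π (s q') (c i * v i y) := by
          refine Finset.sum_congr rfl fun i hi => ?_
          rw [Finsupp.finsetSum_apply]
          conv_rhs => rw [← hcT i hi, Finset.sum_mul, map_sum]
          refine Finset.sum_congr rfl fun q _ => ?_
          rw [mul_assoc, cosetCoeff_kerIncl_mul, Finsupp.smul_apply, hcoords]
          rfl
      _ = cosetCoeff π (s q') ((∑ i ∈ t, c i • v i) y) := by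
          rw [← map_sum, Finsupp.finsetSum_apply]
          rfl
      _ = 0 := by rw [hc]; simp)
  rw [← hcT i hi]
  refine Finset.sum_eq_zero fun q hq => ?_
  rw [h0 (i, q) (Finset.mk_mem_product hi hq)]
  simp

variable (k) in
/-- The properties of the quotients by the terms of the torsion-free derived series on which the
argument rests: the group algebra is an Ore domain (being that of a solvable group with unique
products), and linear independence over it can be checked after augmentation. -/
structure AugReflecting (G : Type u) [Group G] : Prop where
  uniqueProds : UniqueProds G
  isSolvable : Group.IsSolvable G
  linearIndependent : ∀ {S ι : Type u} (v : ι → S →₀ MonoidAlgebra k G),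
    LinearIndependent k (fun i => augVec k G S (v i)) → LinearIndependent (MonoidAlgebra k G) v

theorem AugReflecting.of_subsingleton (G : Type u) [Group G] [Subsingleton G] :
    AugReflecting k G where
  uniqueProds :=
    ⟨fun {A B} hA hB => by
      obtain ⟨a, ha⟩ := hA
      obtain ⟨b, hb⟩ := hB
      exact ⟨a, ha, b, hb, UniqueMul.of_subsingleton⟩⟩
  isSolvable := inferInstance
  linearIndependent {S ι} v h := by
    have hinj : Function.Injective (aug k G) := by
      rw [injective_iff_map_eq_zero]
      intro a ha
      have : a = MonoidAlgebra.single 1 (a.coeff 1) := by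
        ext g
        rw [Subsingleton.elim g 1]
        simp
      rw [this, aug_single] at ha
      rw [this, ha, MonoidAlgebra.single_zero]
    rw [linearIndependent_iff'] at h ⊢
    intro t c hc i hi
    refine hinj ?_
    rw [map_zero]
    refine h t (fun i => aug k G (c i)) ?_ i hi
    rw [← map_zero (augVec k G S), ← hc, map_sum]
    exact Finset.sum_congr rfl fun i _ => (augVec_smul _ _).symm

/-- The conditions pass to extensions with torsion-free abelian kernel. -/
theorem AugReflecting.of_extension {G Q : Type u} [Group G] [Group Q] (π : G →* Q)
    (hπ : Function.Surjective π) (hcomm : ∀ a b : π.ker, a * b = b * a)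
    (htf : ∀ a : π.ker, ∀ n : ℕ, n ≠ 0 → a ^ n = 1 → a = 1) (hQ : AugReflecting k Q) :
    AugReflecting k G := by
  have hker : UniqueProds π.ker := by
    let _ : CommGroup π.ker := { (inferInstance : Group π.ker) with mul_comm := hcomm }
    have : IsMulTorsionFree π.ker := ⟨fun n hn a b hab => by
      refine div_eq_one.1 (htf _ n hn ?_)
      rw [div_pow, div_eq_one]
      exact hab⟩
    exact uniqueProds_of_isMulTorsionFree π.ker
  have := hQ.uniqueProds
  have := hQ.isSolvable
  have hs : Group.IsSolvable π.ker := Group.isSolvable_of_comm hcomm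
  refine ⟨uniqueProds_of_extension π,
    Group.isSolvable_of_ker_le_range π.ker.subtype π (by simp), fun {S ι} v h =>
    linearIndependent_of_mapVec π hπ hcomm v (hQ.linearIndependent _ ?_)⟩
  convert h using 2 with i
  ext y
  rw [augVec_apply, augVec_apply, mapVec_apply]
  induction v i y using MonoidAlgebra.induction_linear with
  | zero => simp
  | add a b ha hb => simp only [map_add, ha, hb]
  | single g c => simp

/-! ### Vectors with vanishing augmentation and the presentation complex -/

/-- Let `p ↦ ∂ p` be a presentation matrix with finitely many relations. If, after augmentation,
`ψ` is injective modulo the image of `∂`, and the kernel of `∂` is hit by the kernel of `∂` over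
`k[G]`, then `ψ` is injective modulo the image of `∂` over `k[G]`, too.

Over `k[G]`, choose independent vectors in the kernel of `∂` which lift a basis of the kernel over
`k`, and further vectors which lift a basis of a complement. A non-zero multiple of `p` is a
combination of all of them, so the same multiple of `∂ p` is a combination of the images of the
further vectors; these images are independent of the image of `ψ`, because they are so over `k`. -/
theorem eq_zero_of_augVec {k : Type u} [Field k] {G : Type u} [Group G] (hG : AugReflecting k G)
    {R S X : Type u} [Finite R]
    (bd : (R →₀ MonoidAlgebra k G) →ₗ[MonoidAlgebra k G] (S →₀ MonoidAlgebra k G))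
    (ψ : (X →₀ MonoidAlgebra k G) →ₗ[MonoidAlgebra k G] (S →₀ MonoidAlgebra k G))
    (h₁ : ∀ p x, augVec k G S (bd p) = augVec k G S (ψ x) → augVec k G X x = 0)
    (h₂ : ∀ p, augVec k G S (bd p) = 0 → ∃ z, bd z = 0 ∧ augVec k G R z = augVec k G R p)
    {p : R →₀ MonoidAlgebra k G} {x : X →₀ MonoidAlgebra k G} (hpx : bd p = ψ x) : x = 0 := by
  classical
  have := Fintype.ofFinite R
  have := hG.uniqueProds
  have := hG.isSolvable
  have := strongRankCondition_of_isSolvable k G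
  -- a basis of `k^R` adapted to the augmentations of the elements of the kernel of `bd`
  let Z : Submodule k (R →₀ k) := ((LinearMap.ker bd).restrictScalars k).map (augVec k G R)
  obtain ⟨C, hC⟩ := Submodule.exists_isCompl Z
  let bZ := Module.Basis.ofVectorSpace k Z
  let bC := Module.Basis.ofVectorSpace k C
  let I := Module.Basis.ofVectorSpaceIndex k Z
  let J := Module.Basis.ofVectorSpaceIndex k C
  let b : Module.Basis (I ⊕ J) k (R →₀ k) :=
    (bZ.prod bC).map (Submodule.prodEquivOfIsCompl Z C hC)
  have hbl : ∀ i, b (Sum.inl i) = bZ i := fun i => by simp [b]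
  have hbr : ∀ j, b (Sum.inr j) = bC j := fun j => by simp [b]
  have hfin : Finite (I ⊕ J) := Module.Finite.finite_basis b
  have : Fintype I := @Fintype.ofFinite _ (Finite.sum_left J)
  have : Fintype J := @Fintype.ofFinite _ (Finite.sum_right I)
  have hcard : Fintype.card (I ⊕ J) = Fintype.card R := by
    rw [← Module.finrank_eq_card_basis b, Module.finrank_finsupp_self]
  have hsurj : ∀ c : R →₀ k, ∃ z, augVec k G R z = c := fun c =>
    ⟨Finsupp.mapRange (algebraMap k (MonoidAlgebra k G)) (map_zero _) c, by ext; simp⟩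
  have hlift : ∀ a, ∃ z, augVec k G R z = b a ∧ ∀ i, a = Sum.inl i → bd z = 0 := by
    rintro (i | j)
    · obtain ⟨z, hz, hzi⟩ := (bZ i).2
      exact ⟨z, hzi.trans (hbl i).symm, fun _ _ => hz⟩
    · obtain ⟨z, hz⟩ := hsurj (b (Sum.inr j))
      exact ⟨z, hz, fun i h => by simp at h⟩
  choose l hl hl0 using hlift
  have hlLI : LinearIndependent (MonoidAlgebra k G) l := by
    refine hG.linearIndependent l ?_
    simp only [hl]
    exact b.linearIndependent
  -- since there are as many vectors `l a` as coordinates, a multiple of `p` is in their span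
  let o : Option (I ⊕ J) → (R →₀ MonoidAlgebra k G) := fun a => a.elim p l
  have hdep : ¬ LinearIndependent (MonoidAlgebra k G) o := by
    intro h
    have h' := h.fintype_card_le_finrank
    rw [Fintype.card_option, Module.finrank_finsupp_self, hcard] at h'
    omega
  obtain ⟨g, hg, a₀, ha₀⟩ := Fintype.not_linearIndependent_iff.1 hdep
  rw [Fintype.sum_option] at hg
  simp only [o, Option.elim] at hg
  have hgn : g none ≠ 0 := by
    intro h0
    rw [h0, zero_smul, zero_add] at hg
    have := Fintype.linearIndependent_iff.1 hlLI _ hg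
    cases a₀ with
    | none => exact ha₀ h0
    | some a => exact ha₀ (this a)
  let w : X ⊕ J → (S →₀ MonoidAlgebra k G) :=
    Sum.elim (fun x => ψ (Finsupp.single x 1)) (fun j => bd (l (Sum.inr j)))
  -- the images under `ψ` and the images of a complement of the kernel are jointly independent
  have hw : LinearIndependent (MonoidAlgebra k G) w := by
    refine hG.linearIndependent w ?_
    rw [linearIndependent_iff]
    intro c hc
    let y : (X ⊕ J →₀ k) →ₗ[k] (X →₀ MonoidAlgebra k G) :=
      Finsupp.linearCombination k (Sum.elim (fun x => Finsupp.single x 1) 0)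
    let r : (X ⊕ J →₀ k) →ₗ[k] (R →₀ MonoidAlgebra k G) :=
      Finsupp.linearCombination k (Sum.elim 0 (fun j => l (Sum.inr j)))
    have hsplit : ∀ c, Finsupp.linearCombination k (fun a => augVec k G S (w a)) c =
        augVec k G S (ψ (y c)) + augVec k G S (bd (r c)) := by
      intro c
      induction c using Finsupp.induction_linear with
      | zero => simp
      | add c d hc hd => simp only [map_add, hc, hd]; abel
      | single a t =>
        rcases a with x | j
        · simp only [y, r, w, Finsupp.linearCombination_single, Sum.elim_inl, Pi.zero_apply,
            smul_zero, map_zero, add_zero, map_smul, LinearMap.map_smul_of_tower]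
        · simp only [y, r, w, Finsupp.linearCombination_single, Sum.elim_inr, Pi.zero_apply,
            smul_zero, map_zero, zero_add, map_smul, LinearMap.map_smul_of_tower]
    rw [hsplit] at hc
    have hy : augVec k G X (y c) = 0 := h₁ (-r c) _ (by
      rw [map_neg, map_neg, neg_eq_iff_add_eq_zero, add_comm]
      exact hc)
    have hyc : ∀ c x, augVec k G X (y c) x = c (Sum.inl x) := by
      intro c x
      induction c using Finsupp.induction_linear with
      | zero => simp
      | add c d hc hd => simp only [map_add, Finsupp.add_apply, hc, hd]
      | single a t => rcases a with x' | j <;> simp [y, Finsupp.single_apply]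
    have hrc : ∀ c j, b.repr (augVec k G R (r c)) (Sum.inr j) = c (Sum.inr j) := by
      intro c j
      induction c using Finsupp.induction_linear with
      | zero => simp
      | add c d hc hd => simp only [map_add, Finsupp.add_apply, hc, hd]
      | single a t =>
        rcases a with x' | j
        · simp [r]
        · simp [r, hl, Finsupp.single_apply]
    have hrC : ∀ c, augVec k G R (r c) ∈ C := by
      intro c
      induction c using Finsupp.induction_linear with
      | zero => simp
      | add c d hc hd => simp only [map_add]; exact C.add_mem hc hd
      | single a t =>
        rcases a with x' | j
        · simp [r]
        · simpa [r, hl, hbr] using C.smul_mem t (bC j).2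
    have hy0 : augVec k G S (ψ (y c)) = 0 := by
      -- the entries of `y c` are constants, so `y c` is determined by its augmentation
      have hy' : y c = 0 := by
        have hform : ∀ c : X ⊕ J →₀ k, y c = Finsupp.mapRange
            (algebraMap k (MonoidAlgebra k G)) (map_zero _) (augVec k G X (y c)) := by
          intro c
          induction c using Finsupp.induction_linear with
          | zero => simp
          | add c d hc hd =>
            rw [map_add, map_add, Finsupp.mapRange_add (fun a b => map_add _ a b), ← hc, ← hd]
          | single a t => rcases a with x' | j <;> simp [y, Algebra.smul_def]
        rw [hform, hy]
        simp
      rw [hy', map_zero, map_zero]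
    rw [hy0, zero_add] at hc
    obtain ⟨z, hz, hzr⟩ := h₂ _ hc
    have hr0 : augVec k G R (r c) = 0 :=
      Submodule.disjoint_def.1 hC.disjoint _ ⟨z, hz, hzr⟩ (hrC c)
    ext a
    rcases a with x' | j
    · rw [← hyc, hy]
      rfl
    · rw [← hrc, hr0]
      simp
  let d : X ⊕ J →₀ MonoidAlgebra k G :=
    (g none • x).mapDomain Sum.inl + ∑ j : J, Finsupp.single (Sum.inr j) (g (some (Sum.inr j)))
  have hd : d = 0 := by
    refine linearIndependent_iff.1 hw d ?_
    have hψ : Finsupp.linearCombination (MonoidAlgebra k G) (w ∘ Sum.inl) (g none • x) =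
        g none • ψ x := by
      have : ψ x = ψ (Finsupp.linearCombination (MonoidAlgebra k G)
          (fun x => Finsupp.single x 1) x) := by
        congr 1
        simp [Finsupp.linearCombination_apply]
      rw [map_smul, this, Finsupp.apply_linearCombination]
      rfl
    have hbd := congrArg bd hg
    rw [map_add, map_smul, hpx, Fintype.sum_sum_type, map_add, map_sum, map_sum, map_zero,
      Finset.sum_eq_zero fun i _ => by rw [map_smul, hl0 _ i rfl, smul_zero], zero_add] at hbd
    rw [map_add, Finsupp.linearCombination_mapDomain, hψ, map_sum, ← hbd]
    congr 1
    refine Finset.sum_congr rfl fun j _ => ?_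
    rw [Finsupp.linearCombination_single, map_smul]
    rfl
  ext1 x'
  have hx' := DFunLike.congr_fun hd (Sum.inl x')
  rw [Finsupp.add_apply, Finsupp.mapDomain_apply Sum.inl_injective, Finsupp.finsetSum_apply,
    Finset.sum_eq_zero fun j _ => Finsupp.single_eq_of_ne (by simp), add_zero] at hx'
  exact (mul_eq_zero.1 hx').resolve_left hgn

/-! ### Fox derivations and the Magnus embedding -/

theorem freeGroupBasis_subgroup_eq_top {X F : Type*} [Group F] (b : FreeGroupBasis X F)
    (H : Subgroup F) (h : ∀ x, b x ∈ H) : H = ⊤ := by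
  rw [eq_top_iff]
  have hid : H.subtype.comp (b.lift fun x => ⟨b x, h x⟩) = MonoidHom.id F :=
    b.ext_hom _ _ fun x => by simp
  intro f _
  rw [← MonoidHom.id_apply (M := F) f, ← hid]
  exact SetLike.coe_mem _

section Derivation

variable {k : Type*} [CommRing k] {F Γ V : Type*} [Group F] [Group Γ] [AddCommGroup V]
  [Module (MonoidAlgebra k Γ) V]

/-- `D : F → V` is a derivation, where `F` acts on the `k[Γ]`-module `V` through `π : F → Γ`. -/
def IsDerivation (k : Type*) [CommRing k] [Module (MonoidAlgebra k Γ) V] (π : F →* Γ)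
    (D : F → V) : Prop :=
  ∀ g h, D (g * h) = D g + (MonoidAlgebra.single (π g) 1 : MonoidAlgebra k Γ) • D h

theorem single_smul_single_smul (g h : Γ) (v : V) :
    (MonoidAlgebra.single g 1 : MonoidAlgebra k Γ) •
      (MonoidAlgebra.single h 1 : MonoidAlgebra k Γ) • v =
      (MonoidAlgebra.single (g * h) 1 : MonoidAlgebra k Γ) • v := by
  rw [smul_smul, MonoidAlgebra.single_mul_single, one_mul]

theorem single_one_smul (v : V) : (MonoidAlgebra.single (1 : Γ) 1 : MonoidAlgebra k Γ) • v = v := by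
  rw [← MonoidAlgebra.one_def, one_smul]

namespace IsDerivation

variable {π : F →* Γ} {D D' : F → V} (hD : IsDerivation k π D)
include hD

theorem map_one : D 1 = 0 := by
  have h := hD 1 1
  rw [mul_one, _root_.map_one, single_one_smul] at h
  exact left_eq_add.1 h

theorem map_inv (g : F) : D g⁻¹ = -((MonoidAlgebra.single (π g)⁻¹ 1 : MonoidAlgebra k Γ) • D g) := by
  have h := hD g⁻¹ g
  rw [inv_mul_cancel, hD.map_one, _root_.map_inv] at h
  exact eq_neg_of_add_eq_zero_left h.symm

theorem map_mul_of_mem {g : F} (hg : π g = 1) (h : F) : D (g * h) = D g + D h := by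
  rw [hD, hg, single_one_smul]

theorem map_inv_of_mem {g : F} (hg : π g = 1) : D g⁻¹ = -D g := by
  rw [hD.map_inv, hg, inv_one, single_one_smul]

theorem map_conj {n : F} (hn : π n = 1) (g : F) :
    D (g * n * g⁻¹) = (MonoidAlgebra.single (π g) 1 : MonoidAlgebra k Γ) • D n := by
  rw [hD, hD, hD.map_inv, smul_neg, single_smul_single_smul, map_mul, hn, mul_one,
    mul_inv_cancel, single_one_smul]
  abel

theorem map_div_of_eq {g h : F} (hgh : π g = π h) : D (g * h⁻¹) = D g - D h := by
  rw [hD, hD.map_inv, smul_neg, single_smul_single_smul, hgh, mul_inv_cancel, single_one_smul,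
    sub_eq_add_neg]

theorem comp {F' : Type*} [Group F'] (f : F' →* F) : IsDerivation k (π.comp f) (D ∘ f) := by
  intro g h
  simp [hD (f g) (f h)]

theorem map {V' : Type*} [AddCommGroup V'] [Module (MonoidAlgebra k Γ) V']
    (L : V →ₗ[MonoidAlgebra k Γ] V') : IsDerivation k π (fun g => L (D g)) := by
  intro g h
  simp [hD g h]

theorem ext_basis {X : Type*} (b : FreeGroupBasis X F) (hD' : IsDerivation k π D')
    (h : ∀ x, D (b x) = D' (b x)) : D = D' := by
  let H : Subgroup F :=
    { carrier := {g | D g = D' g}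
      one_mem' := hD.map_one.trans hD'.map_one.symm
      mul_mem' := fun {g h} hg hh => by
        simp only [Set.mem_ofPred_eq] at hg hh ⊢
        rw [hD, hD', hg, hh]
      inv_mem' := fun {g} hg => by
        simp only [Set.mem_ofPred_eq] at hg ⊢
        rw [hD.map_inv, hD'.map_inv, hg] }
  have hH := freeGroupBasis_subgroup_eq_top b H h
  funext g
  exact (hH ▸ Subgroup.mem_top g : g ∈ H)

end IsDerivation

/-- Derivations on a free group exist with prescribed values on a basis: `D f` is the image of `0`
under the affine action of `f` for which a basis element `x` acts as `v ↦ w x + π x • v`. -/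
theorem exists_isDerivation {X : Type*} (b : FreeGroupBasis X F) (π : F →* Γ) (w : X → V) :
    ∃ D : F → V, IsDerivation k π D ∧ ∀ x, D (b x) = w x := by
  let act : Γ → V → V := fun g v => (MonoidAlgebra.single g 1 : MonoidAlgebra k Γ) • v
  have hact : ∀ g h v, act g (act h v) = act (g * h) v := single_smul_single_smul
  have hact1 : ∀ v, act 1 v = v := single_one_smul
  let P : F →* Equiv.Perm V := b.lift fun x =>
    { toFun := fun v => w x + act (π (b x)) v
      invFun := fun v => act (π (b x))⁻¹ (v - w x)
      left_inv := fun v => by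
        beta_reduce
        rw [add_sub_cancel_left, hact, inv_mul_cancel, hact1]
      right_inv := fun v => by
        beta_reduce
        rw [hact, mul_inv_cancel, hact1, add_sub_cancel] }
  have hPb : ∀ x v, P (b x) v = w x + act (π (b x)) v := fun x v => by simp [P]
  have hadd : ∀ g u v, act g (u + v) = act g u + act g v := fun g u v => smul_add _ _ _
  have hzero : ∀ g, act g 0 = 0 := fun g => smul_zero _
  let H : Subgroup F :=
    { carrier := {g | ∀ v, P g v = P g 0 + act (π g) v}
      one_mem' := fun v => by simp [hact1]
      mul_mem' := fun {g h} hg hh v => by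
        rw [map_mul, Equiv.Perm.mul_apply, Equiv.Perm.mul_apply, hh v, hg, hg (P h 0), hadd, hact,
          map_mul, add_assoc]
      inv_mem' := fun {g} hg v => by
        apply (P g).injective
        rw [hg (P g⁻¹ 0 + _), hadd, ← add_assoc, ← hg, hact, ← Equiv.Perm.mul_apply,
          ← Equiv.Perm.mul_apply, ← map_mul, ← map_mul, mul_inv_cancel]
        simp [hact1] }
  have hH := freeGroupBasis_subgroup_eq_top b H fun x v => by rw [hPb, hPb, hzero, add_zero]
  refine ⟨fun g => P g 0, fun g h => ?_, fun x => ?_⟩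
  · beta_reduce
    rw [map_mul, Equiv.Perm.mul_apply]
    exact (hH ▸ Subgroup.mem_top g : g ∈ H) _
  · change P (b x) 0 = w x
    rw [hPb, hzero, add_zero]

end Derivation

/-- The Fox derivation `F → k[Γ]^X` of a free group with basis `X` along `π : F → Γ`, which sends
the basis elements to the standard unit vectors. -/
noncomputable def foxDerivation (k : Type*) [CommRing k] {X F Γ : Type*} [Group F] [Group Γ]
    (b : FreeGroupBasis X F) (π : F →* Γ) : F → (X →₀ MonoidAlgebra k Γ) :=
  (exists_isDerivation (k := k) b π fun x => Finsupp.single x (1 : MonoidAlgebra k Γ)).choose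

section Fox

variable {k : Type*} [CommRing k] {X F Γ : Type*} [Group F] [Group Γ]
  (b : FreeGroupBasis X F) (π : F →* Γ)

theorem isDerivation_foxDerivation : IsDerivation k π (foxDerivation k b π) :=
  (exists_isDerivation b π fun x => Finsupp.single x 1).choose_spec.1

@[simp]
theorem foxDerivation_basis (x : X) : foxDerivation k b π (b x) = Finsupp.single x 1 :=
  (exists_isDerivation b π fun x => Finsupp.single x 1).choose_spec.2 x

/-- Every derivation is a linear image of the Fox derivation. -/
theorem IsDerivation.eq_linearCombination {V : Type*} [AddCommGroup V]
    [Module (MonoidAlgebra k Γ) V] {D : F → V} (hD : IsDerivation k π D) (f : F) :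
    D f = Finsupp.linearCombination (MonoidAlgebra k Γ) (fun x => D (b x))
      (foxDerivation k b π f) := by
  refine congrFun (hD.ext_basis b ((isDerivation_foxDerivation b π).map _) fun x => ?_) f
  simp

/-- A retraction of the Magnus embedding shows that the Fox derivation detects the commutator
subgroup of `ker π` inside `ker π`: with a transversal `σ`, it sends `q e_x` to the class of the
Schreier generator `σ(q) x σ(q x)⁻¹`. -/
theorem mem_commutator_ker_of_foxDerivation_int {f : F} (hf : f ∈ π.ker)
    (h0 : foxDerivation ℤ b π f = 0) : f ∈ ⁅π.ker, π.ker⁆ := by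
  classical
  let σ : Γ → F := fun q => if h : q ∈ π.range then h.choose else 1
  have hσ : ∀ q ∈ π.range, π (σ q) = q := fun q h => by
    simp only [σ, dif_pos h]
    exact h.choose_spec
  let A := Additive (Abelianization π.ker)
  let cls : F → A := fun t => if h : t ∈ π.ker then Additive.ofMul (Abelianization.of ⟨t, h⟩) else 0
  have hcls : ∀ t u, t ∈ π.ker → u ∈ π.ker → cls (t * u) = cls t + cls u := by
    intro t u ht hu
    simp only [cls, dif_pos ht, dif_pos hu, dif_pos (mul_mem ht hu)]
    rw [← ofMul_mul, ← map_mul]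
    rfl
  let t : Γ → F → F := fun q f => σ q * f * (σ (q * π f))⁻¹
  have ht : ∀ q ∈ π.range, ∀ f, t q f ∈ π.ker := by
    intro q hq f
    have hqf : q * π f ∈ π.range := mul_mem hq ⟨f, rfl⟩
    simp [t, MonoidHom.mem_ker, hσ q hq, hσ _ hqf]
  have htmul : ∀ q ∈ π.range, ∀ f g, cls (t q (f * g)) = cls (t q f) + cls (t (q * π f) g) := by
    intro q hq f g
    rw [← hcls _ _ (ht q hq f) (ht _ (mul_mem hq ⟨f, rfl⟩) g)]
    congr 1
    simp only [t, map_mul]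
    group
  let Ψ : (X →₀ MonoidAlgebra ℤ Γ) →+ A := Finsupp.liftAddHom fun x =>
    (Finsupp.liftAddHom fun q => (zmultiplesHom A) (cls (t q (b x)))).comp
      MonoidAlgebra.coeffAddEquiv.toAddMonoidHom
  let shift : Γ → (X →₀ MonoidAlgebra ℤ Γ) → (X →₀ MonoidAlgebra ℤ Γ) := fun q v =>
    (MonoidAlgebra.single q 1 : MonoidAlgebra ℤ Γ) • v
  have hD := isDerivation_foxDerivation (k := ℤ) b π
  have hshift : ∀ q f g, shift q (foxDerivation ℤ b π (f * g)) =
      shift q (foxDerivation ℤ b π f) + shift (q * π f) (foxDerivation ℤ b π g) := by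
    intro q f g
    simp only [shift]
    rw [hD, smul_add, single_smul_single_smul]
  let H : Subgroup F :=
    { carrier := {f | ∀ q ∈ π.range, Ψ (shift q (foxDerivation ℤ b π f)) = cls (t q f)}
      one_mem' := fun q hq => by
        have h1 := htmul q hq 1 1
        rw [mul_one, map_one, mul_one] at h1
        simp only [shift]
        rw [hD.map_one, smul_zero, map_zero, left_eq_add.1 h1]
      mul_mem' := fun {f g} hf hg q hq => by
        rw [hshift, map_add, hf q hq, hg _ (mul_mem hq ⟨f, rfl⟩), htmul q hq]
      inv_mem' := fun {f} hf q hq => by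
        have hq' : q * π f⁻¹ ∈ π.range := mul_mem hq ⟨f⁻¹, rfl⟩
        have h1 := htmul q hq f⁻¹ f
        have h2 := hshift q f⁻¹ f
        have h3 := htmul q hq 1 1
        rw [mul_one, map_one, mul_one] at h3
        rw [inv_mul_cancel, left_eq_add.1 h3] at h1
        rw [inv_mul_cancel, hD.map_one] at h2
        have h4 : shift q (0 : X →₀ MonoidAlgebra ℤ Γ) = 0 := smul_zero _
        have h5 := congrArg Ψ h2
        rw [h4, map_zero, map_add, hf _ hq'] at h5
        exact (eq_neg_of_add_eq_zero_left h5.symm).trans (eq_neg_of_add_eq_zero_left h1.symm).symm }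
  have hH := freeGroupBasis_subgroup_eq_top b H fun x q hq => by
    simp [shift, Ψ]
  have hfH := (hH ▸ Subgroup.mem_top f : f ∈ H) 1 (one_mem _)
  have h4 : shift 1 (0 : X →₀ MonoidAlgebra ℤ Γ) = 0 := smul_zero _
  rw [h0, h4, map_zero] at hfH
  -- `t 1 f` is a conjugate of `f`
  have htf : t 1 f = σ 1 * f * (σ 1)⁻¹ := by simp [t, π.mem_ker.1 hf]
  have hmem := ht 1 (one_mem _) f
  have hcomm : t 1 f ∈ ⁅π.ker, π.ker⁆ := by
    have h1 : Abelianization.of (⟨t 1 f, hmem⟩ : π.ker) = 1 := by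
      have : cls (t 1 f) = Additive.ofMul (Abelianization.of ⟨t 1 f, hmem⟩) := dif_pos hmem
      rw [this] at hfH
      exact (ofMul_eq_zero.1 hfH.symm)
    rw [← MonoidHom.mem_ker, Abelianization.ker_of] at h1
    have h2 := Subgroup.mem_map_of_mem π.ker.subtype h1
    rw [Subgroup.map_subtype_commutator] at h2
    exact h2
  rw [htf] at hcomm
  have := Subgroup.Normal.conj_mem (inferInstance : (⁅π.ker, π.ker⁆).Normal) _ hcomm (σ 1)⁻¹
  simpa [mul_assoc] using this

/-- Magnus' theorem: an element of `ker π` all of whose Fox derivatives vanish is in the commutator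
subgroup of `ker π`. -/
theorem mem_commutator_ker_of_foxDerivation [CharZero k] {f : F} (hf : f ∈ π.ker)
    (h0 : foxDerivation k b π f = 0) : f ∈ ⁅π.ker, π.ker⁆ := by
  refine mem_commutator_ker_of_foxDerivation_int b π hf ?_
  let c : MonoidAlgebra ℤ Γ →+* MonoidAlgebra k Γ := MonoidAlgebra.mapRingHom Γ (Int.castRingHom k)
  have hc : Function.Injective c := by
    intro x y hxy
    ext g
    have := congrArg (fun a => a.coeff g) hxy
    simpa [c] using this
  let D : F → (X →₀ MonoidAlgebra k Γ) := fun g =>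
    Finsupp.mapRange c (map_zero c) (foxDerivation ℤ b π g)
  have hD : IsDerivation k π D := by
    intro g h
    ext1 x
    simp [D, isDerivation_foxDerivation (k := ℤ) b π g h, c]
  have hDeq : D = foxDerivation k b π :=
    hD.ext_basis b (isDerivation_foxDerivation b π) fun x => by simp [D, c]
  ext1 x
  refine hc ?_
  have := DFunLike.congr_fun (congrFun hDeq f) x
  rw [h0] at this
  simpa [D] using this

end Fox

/-! ### Low-dimensional homology with trivial coefficients -/

section Homology

variable (k : Type u) [CommRing k] (G : Type u) [Group G]

/-- The bar differential in degree two, with trivial coefficients. -/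
noncomputable def bar₂ : (G × G →₀ k) →ₗ[k] (G →₀ k) :=
  (groupHomology.d₂₁ (Rep.trivial k G k)).hom

/-- The bar differential in degree three, with trivial coefficients. -/
noncomputable def bar₃ : (G × G × G →₀ k) →ₗ[k] (G × G →₀ k) :=
  (groupHomology.d₃₂ (Rep.trivial k G k)).hom

variable {k G}

theorem bar₂_single (g h : G) (a : k) : bar₂ k G (Finsupp.single (g, h) a) =
    Finsupp.single h a - Finsupp.single (g * h) a + Finsupp.single g a :=
  groupHomology.d₂₁_single (A := Rep.trivial k G k) (g, h) a

theorem bar₃_single (g h j : G) (a : k) : bar₃ k G (Finsupp.single (g, h, j) a) =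
    Finsupp.single (h, j) a - Finsupp.single (g * h, j) a + Finsupp.single (g, h * j) a -
      Finsupp.single (g, h) a :=
  groupHomology.d₃₂_single (A := Rep.trivial k G k) (g, h, j) a

variable (k G) in
/-- The class in `H₁(G; k)` of a 1-chain; every 1-chain is a cycle. -/
noncomputable def classOne : (G →₀ k) →ₗ[k] trivialHomology k G 1 :=
  (groupHomology.H1π (Rep.trivial k G k)).hom ∘ₗ
    (groupHomology.cycles₁IsoOfIsTrivial (Rep.trivial k G k)).inv.hom

theorem classOne_eq_zero_iff (c : G →₀ k) : classOne k G c = 0 ↔ ∃ y, bar₂ k G y = c :=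
  groupHomology.H1π_eq_zero_iff _

theorem classOne_single_mul (g h : G) : classOne k G (Finsupp.single (g * h) 1) =
    classOne k G (Finsupp.single g 1) + classOne k G (Finsupp.single h 1) := by
  rw [← map_add, ← sub_eq_zero, ← map_sub, classOne_eq_zero_iff]
  refine ⟨-Finsupp.single (g, h) 1, ?_⟩
  rw [map_neg, bar₂_single]
  abel

theorem trivialHomologyMap_classOne {K : Type u} [Group K] (f : G →* K) (c : G →₀ k) :
    trivialHomologyMap k f 1 (classOne k G c) = classOne k K (c.mapDomain f) := by
  have h := groupHomology.H1π_comp_map_apply (A := Rep.trivial k G k) (B := Rep.trivial k K k) f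
    (Rep.ofHom ⟨LinearMap.id, fun _ => rfl⟩)
    ((groupHomology.cycles₁IsoOfIsTrivial (Rep.trivial k G k)).inv.hom c)
  refine h.trans ?_
  change (groupHomology.H1π (Rep.trivial k K k)).hom _ =
    (groupHomology.H1π (Rep.trivial k K k)).hom _
  congr 1
  refine Subtype.ext ?_
  refine (groupHomology.coe_mapCycles₁ ..).trans ?_
  change Finsupp.mapRange.linearMap LinearMap.id (Finsupp.mapDomain f c) = Finsupp.mapDomain f c
  rw [Finsupp.mapRange.linearMap_id, LinearMap.id_apply]

end Homology

theorem chainCoeffMap_mapDomain {R S : Type u} [CommRing R] [CommRing S] (c : R →+* S)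
    {X Y : Type u} (f : X → Y) (x : X →₀ R) :
    chainCoeffMap c Y (x.mapDomain f) = (chainCoeffMap c X x).mapDomain f := by
  induction x using Finsupp.induction_linear with
  | zero => simp
  | add x y hx hy => simp only [map_add, Finsupp.mapDomain_add, hx, hy]
  | single x r => simp only [chainCoeffMap_single, Finsupp.mapDomain_single]

/-- A linear map on 2-chains which vanishes on boundaries and on the cycles of `N` vanishes
on all cycles, if `H₂(G; ℚ)` is spanned by `N`-surfaces. -/
theorem eq_zero_of_H₂SpannedBySurfaces {G : Type u} [Group G] {N : Subgroup G}
    (hN : H₂SpannedBySurfaces N) {M : Type*} [AddCommGroup M] [Module RatCoeff.{u} M]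
    (Θ : (G × G →₀ RatCoeff.{u}) →ₗ[RatCoeff.{u}] M)
    (hbd : ∀ y, Θ (bar₃ RatCoeff G y) = 0)
    (hcyc : ∀ z, bar₂ RatCoeff N z = 0 → Θ (z.mapDomain (Prod.map (↑) (↑))) = 0)
    {ζ : G × G →₀ RatCoeff.{u}} (hζ : bar₂ RatCoeff G ζ = 0) : Θ ζ = 0 := by
  let A := Rep.trivial RatCoeff.{u} G RatCoeff.{u}
  let W : Submodule RatCoeff.{u} (trivialHomology RatCoeff.{u} G 2) :=
    (LinearMap.ker (Θ ∘ₗ (groupHomology.cycles₂ A).subtype)).map (groupHomology.H2π A).hom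
  have hW : W = ⊤ := by
    rw [eq_top_iff, ← (show Submodule.span _ _ = _ from hN), Submodule.span_le]
    rintro _ ⟨_, ⟨h, rfl⟩, rfl⟩
    obtain ⟨ν, rfl⟩ := (ModuleCat.epi_iff_surjective
      (groupHomology.H2π (Rep.trivial IntCoeff.{u} N IntCoeff.{u}))).1 inferInstance h
    have h1 := groupHomology.H2π_comp_map_apply (A := Rep.trivial IntCoeff.{u} N IntCoeff.{u})
      (B := Rep.trivial IntCoeff.{u} G IntCoeff.{u}) N.subtype
      (Rep.ofHom ⟨LinearMap.id, fun _ => rfl⟩) ν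
    have h2 : trivialHomologyMap IntCoeff.{u} N.subtype 2 ((groupHomology.H2π
      (Rep.trivial IntCoeff.{u} N IntCoeff.{u})).hom ν) = _ := h1
    rw [h2]
    refine ⟨_, ?_, (H₂CoeffMap_π intToRat G _).symm⟩
    have h3 := hcyc (chainCoeffMap intToRat _ ν.1) ?_
    · rw [SetLike.mem_coe, LinearMap.mem_ker, ← h3]
      change Θ _ = Θ _
      congr 1
      refine (congrArg (chainCoeffMap intToRat (G × G)) (groupHomology.coe_mapCycles₂ ..)).trans ?_
      refine Eq.trans ?_ (chainCoeffMap_mapDomain intToRat _ ν.1)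
      congr 1
      change Finsupp.mapRange.linearMap LinearMap.id (Finsupp.mapDomain _ ν.1) = _
      rw [Finsupp.mapRange.linearMap_id, LinearMap.id_apply]
      rfl
    · have h4 := chainCoeffMap_d₂₁ intToRat N ν.1
      exact h4.trans ((congrArg _ ν.2).trans (map_zero _))
  obtain ⟨ζ', hζ', h⟩ := (hW ▸ Submodule.mem_top :
    (groupHomology.H2π A).hom ⟨ζ, hζ⟩ ∈ W)
  obtain ⟨y, hy⟩ := (groupHomology.H2π_eq_iff (A := A) ζ' ⟨ζ, hζ⟩).1 h
  have h1 := hbd y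
  rw [show bar₃ RatCoeff G y = ζ'.1 - ζ from hy, map_sub, sub_eq_zero] at h1
  rw [← h1]
  exact hζ'

theorem bar₂_mapDomain {k : Type u} [CommRing k] {G K : Type u} [Group G] [Group K] (f : G →* K)
    (z : G × G →₀ k) : bar₂ k K (z.mapDomain (Prod.map f f)) = (bar₂ k G z).mapDomain f := by
  induction z using Finsupp.induction_linear with
  | zero => simp
  | add x y hx hy => simp only [map_add, Finsupp.mapDomain_add, hx, hy]
  | single g a =>
    obtain ⟨g, h⟩ := g
    rw [Finsupp.mapDomain_single, Prod.map_apply, bar₂_single, bar₂_single, ← map_mul,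
      ← Finsupp.mapDomain_single (f := f), ← Finsupp.mapDomain_single (f := f),
      ← Finsupp.mapDomain_single (f := f), Finsupp.mapDomain_add]
    congr 1
    exact (map_sub (Finsupp.mapDomain.addMonoidHom (M := k) f) _ _).symm

/-- The condition of being spanned by `N`-surfaces weakens as `N` grows, in the form in which it is
used: a linear map on 2-chains which vanishes on boundaries and on the cycles of a larger subgroup
`N'` vanishes on all cycles. -/
theorem H₂SpannedBySurfaces.eq_zero_of_le {G : Type u} [Group G] {N N' : Subgroup G} (hNN' : N ≤ N')
    (hN : H₂SpannedBySurfaces N) {M : Type*} [AddCommGroup M] [Module RatCoeff.{u} M]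
    (Θ : (G × G →₀ RatCoeff.{u}) →ₗ[RatCoeff.{u}] M)
    (hbd : ∀ y, Θ (bar₃ RatCoeff G y) = 0)
    (hcyc : ∀ z, bar₂ RatCoeff N' z = 0 → Θ (z.mapDomain (Prod.map (↑) (↑))) = 0)
    (ζ : G × G →₀ RatCoeff.{u}) (hζ : bar₂ RatCoeff G ζ = 0) : Θ ζ = 0 := by
  refine eq_zero_of_H₂SpannedBySurfaces hN Θ hbd (fun z hz => ?_) hζ
  have h := hcyc (z.mapDomain (Prod.map (Subgroup.inclusion hNN') (Subgroup.inclusion hNN')))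
    (by rw [bar₂_mapDomain, hz, Finsupp.mapDomain_zero])
  rwa [← Finsupp.mapDomain_comp] at h

/-! ### The presentation complex -/

section Presentation

variable {k : Type u} [Field k] {E B Γ : Type u} [Group E] [Group B] [Group Γ]
  {R S : Type u} (b : FreeGroupBasis S E) (ρ : E →* B) (rel : R → E) (q : B →* Γ)

theorem freeGroupBasis_ext_add {X F M : Type*} [Group F] [AddCommGroup M]
    (b : FreeGroupBasis X F) {χ χ' : F → M} (h : ∀ f g, χ (f * g) = χ f + χ g)
    (h' : ∀ f g, χ' (f * g) = χ' f + χ' g) (hb : ∀ x, χ (b x) = χ' (b x)) (f : F) :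
    χ f = χ' f := by
  have hhom : ∀ {χ : F → M}, (∀ f g, χ (f * g) = χ f + χ g) →
      ∃ c : F →* Multiplicative M, ∀ f, (c f).toAdd = χ f := fun {χ} h =>
    ⟨MonoidHom.mk' (fun f => Multiplicative.ofAdd (χ f)) fun f g => by rw [h, ofAdd_add],
      fun _ => rfl⟩
  obtain ⟨c, hc⟩ := hhom h
  obtain ⟨c', hc'⟩ := hhom h'
  have : c = c' := b.ext_hom _ _ fun x => Multiplicative.toAdd.injective (by rw [hc, hc', hb])
  rw [← hc, ← hc', this]

theorem augVec_linearCombination {X : Type*} (v : X → S →₀ MonoidAlgebra k Γ)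
    (p : X →₀ MonoidAlgebra k Γ) :
    augVec k Γ S (Finsupp.linearCombination (MonoidAlgebra k Γ) v p) =
      Finsupp.linearCombination k (fun x => augVec k Γ S (v x)) (augVec k Γ X p) := by
  induction p using Finsupp.induction_linear with
  | zero => simp
  | add x y hx hy => simp only [map_add, hx, hy]
  | single x r => simp only [Finsupp.linearCombination_single, augVec_smul, augVec_single]

variable (k) in
/-- The matrix of Fox derivatives of the relators: the second boundary map of the universal cover
of the presentation complex, with coefficients in `k[Γ]`. -/
noncomputable def relatorMap :
    (R →₀ MonoidAlgebra k Γ) →ₗ[MonoidAlgebra k Γ] (S →₀ MonoidAlgebra k Γ) :=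
  Finsupp.linearCombination (MonoidAlgebra k Γ) fun r => foxDerivation k b (q.comp ρ) (rel r)

variable {b ρ rel q}

theorem augVec_foxDerivation_mul (π : E →* Γ) (e e' : E) :
    augVec k Γ S (foxDerivation k b π (e * e')) =
      augVec k Γ S (foxDerivation k b π e) + augVec k Γ S (foxDerivation k b π e') := by
  rw [isDerivation_foxDerivation b π e e', map_add, augVec_smul, aug_single, one_smul]

variable (hker : Subgroup.normalClosure (Set.range rel) = ρ.ker)
include hker

theorem rho_rel (r : R) : ρ (rel r) = 1 := by
  rw [← MonoidHom.mem_ker, ← hker]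
  exact Subgroup.subset_normalClosure ⟨r, rfl⟩

/-- The Fox derivatives of a consequence of the relators are a combination of those of the
relators. -/
theorem foxDerivation_mem_range {e : E} (he : ρ e = 1) :
    foxDerivation k b (q.comp ρ) e ∈ LinearMap.range (relatorMap k b ρ rel q) := by
  have hD := isDerivation_foxDerivation (k := k) b (q.comp ρ)
  have hq : ∀ {e}, ρ e = 1 → q.comp ρ e = 1 := fun {e} h => by
    rw [MonoidHom.comp_apply, h, map_one]
  let H : Subgroup E :=
    { carrier := {e | ρ e = 1 ∧
        foxDerivation k b (q.comp ρ) e ∈ LinearMap.range (relatorMap k b ρ rel q)}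
      one_mem' := ⟨map_one _, by rw [hD.map_one]; exact zero_mem _⟩
      mul_mem' := fun {e e'} he he' => ⟨by rw [map_mul, he.1, he'.1, one_mul], by
        rw [hD.map_mul_of_mem (hq he.1)]
        exact add_mem he.2 he'.2⟩
      inv_mem' := fun {e} he => ⟨by rw [map_inv, he.1, inv_one], by
        rw [hD.map_inv_of_mem (hq he.1)]
        exact neg_mem he.2⟩ }
  have hH : H.Normal := ⟨fun n hn g => ⟨by simp [hn.1], by
    rw [hD.map_conj (hq hn.1)]
    exact Submodule.smul_mem _ _ hn.2⟩⟩
  have hle : ρ.ker ≤ H := by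
    rw [← hker]
    refine Subgroup.normalClosure_le_normal ?_
    rintro _ ⟨r, rfl⟩
    exact ⟨rho_rel hker r, Finsupp.single r 1, by simp [relatorMap]⟩
  exact (hle he).2

theorem foxDerivation_sub_mem_range {e e' : E} (he : ρ e = ρ e') :
    foxDerivation k b (q.comp ρ) e - foxDerivation k b (q.comp ρ) e' ∈
      LinearMap.range (relatorMap k b ρ rel q) := by
  rw [← (isDerivation_foxDerivation b (q.comp ρ)).map_div_of_eq (by simp [he])]
  exact foxDerivation_mem_range hker (by simp [he])

/-- If `F → B` induces an injection on `H₁(–; k)`, then it induces an injection from `k^X` to the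
cokernel of the augmented matrix of Fox derivatives. -/
theorem augVec_eq_zero_of_injective {X F : Type u} [Group F] (b' : FreeGroupBasis X F)
    {φ : F →* B} (hφ : Function.Injective (trivialHomologyMap k φ 1)) {φ' : F →* E}
    (hφ' : ρ.comp φ' = φ) {p : R →₀ MonoidAlgebra k Γ} {x : X →₀ MonoidAlgebra k Γ}
    (h : augVec k Γ S (relatorMap k b ρ rel q p) = augVec k Γ S
      (Finsupp.linearCombination (MonoidAlgebra k Γ)
        (fun x => foxDerivation k b (q.comp ρ) (φ' (b' x))) x)) :
    augVec k Γ X x = 0 := by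
  set D := foxDerivation k b (q.comp ρ) with hD
  set c := augVec k Γ R p
  set d := augVec k Γ X x
  rw [relatorMap, augVec_linearCombination, augVec_linearCombination] at h
  -- the class of `ρ e` in `H₁(B; k)` is a linear function of the augmentation of `D e`
  let L : (S →₀ k) →ₗ[k] trivialHomology k B 1 :=
    Finsupp.linearCombination k fun s => classOne k B (Finsupp.single (ρ (b s)) 1)
  have hL : ∀ e, classOne k B (Finsupp.single (ρ e) 1) = L (augVec k Γ S (D e)) := by
    refine freeGroupBasis_ext_add b (χ := fun e => classOne k B (Finsupp.single (ρ e) 1))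
      (χ' := fun e => L (augVec k Γ S (D e))) (fun e e' => ?_) (fun e e' => ?_) fun s => ?_
    · rw [map_mul, classOne_single_mul]
    · rw [hD, augVec_foxDerivation_mul, map_add]
    · simp [L, hD, MonoidAlgebra.one_def]
  have hone : classOne k B (Finsupp.single 1 1) = 0 := by
    have := classOne_single_mul (k := k) (1 : B) 1
    rw [mul_one] at this
    exact left_eq_add.1 this
  have hLh := congrArg L h
  rw [Finsupp.apply_linearCombination, Finsupp.apply_linearCombination] at hLh
  have h1 : (L ∘ fun r => augVec k Γ S (D (rel r))) = 0 := by
    funext r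
    rw [Function.comp_apply, ← hL, rho_rel hker, hone]
    rfl
  have h2 : (L ∘ fun x => augVec k Γ S (D (φ' (b' x)))) =
      (classOne k B ∘ₗ Finsupp.lmapDomain k k φ) ∘ fun x => Finsupp.single (b' x) (1 : k) := by
    funext x
    rw [Function.comp_apply, ← hL, ← MonoidHom.comp_apply, hφ']
    simp
  rw [h1, h2, ← Finsupp.apply_linearCombination, Finsupp.linearCombination_zero,
    LinearMap.zero_apply, LinearMap.comp_apply, Finsupp.lmapDomain_apply,
    ← trivialHomologyMap_classOne] at hLh
  have h3 := hφ (hLh.symm.trans (map_zero _).symm)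
  obtain ⟨y, hy⟩ := (classOne_eq_zero_iff _).1 h3
  -- the exponent sums define a functional on 1-chains of `F` which vanishes on boundaries
  let χ : F → (X →₀ k) := fun f => augVec k Γ X (foxDerivation k b' (1 : F →* Γ) f)
  have hχ : ∀ f g, χ (f * g) = χ f + χ g := fun f g => augVec_foxDerivation_mul (b := b') _ f g
  have h4 : ∀ y, Finsupp.linearCombination k χ (bar₂ k F y) = 0 := by
    intro y
    induction y using Finsupp.induction_linear with
    | zero => simp
    | add x y hx hy => simp only [map_add, hx, hy, add_zero]
    | single g a =>
      obtain ⟨g, h⟩ := g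
      simp only [bar₂_single, map_add, map_sub, Finsupp.linearCombination_single, hχ, smul_add]
      abel
  have h5 := h4 y
  rw [hy, Finsupp.apply_linearCombination] at h5
  rw [← h5]
  have h6 : (Finsupp.linearCombination k χ ∘ fun x => Finsupp.single (b' x) (1 : k)) =
      fun x => Finsupp.single x 1 := by
    funext x
    simp [χ, MonoidAlgebra.one_def]
  rw [h6]
  simp [Finsupp.linearCombination_apply, d]

/-- If `H₂(B; ℚ)` is spanned by `ker q`-surfaces, then the kernel of the augmented matrix of Fox
derivatives lifts to the kernel of that matrix over the group algebra of the image of `q`. The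
derivation `δ`, defined on `B` up to the image of the matrix, gives a 2-cocycle `Θ` of `B` with
values in the augmentation coinvariants of the image. It vanishes on cycles of `ker q`, where `δ` is
additive; on the other hand its values on cycles include the class of each vector `bd p` of
vanishing augmentation, since `e ↦ (D e - δ (ρ e), [ρ e])` is additive modulo the graph of `Θ`. -/
theorem exists_augVec_eq_of_surfaces (hρ : Function.Surjective ρ)
    (hcycles : ∀ {M : Type u} [AddCommGroup M] [Module k M] (Θ : (B × B →₀ k) →ₗ[k] M),
      (∀ y, Θ (bar₃ k B y) = 0) →
      (∀ z, bar₂ k q.ker z = 0 → Θ (z.mapDomain (Prod.map (↑) (↑))) = 0) →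
      ∀ ζ, bar₂ k B ζ = 0 → Θ ζ = 0)
    (p : R →₀ MonoidAlgebra k Γ) (hp : augVec k Γ S (relatorMap k b ρ rel q p) = 0) :
    ∃ z, relatorMap k b ρ rel q z = 0 ∧ augVec k Γ R z = augVec k Γ R p := by
  set bd := relatorMap k b ρ rel q with hbd
  set D := foxDerivation k b (q.comp ρ) with hDdef
  have hD : IsDerivation k (q.comp ρ) D := isDerivation_foxDerivation b (q.comp ρ)
  obtain ⟨σ, hσ⟩ := hρ.hasRightInverse
  let act : Γ → (S →₀ MonoidAlgebra k Γ) → (S →₀ MonoidAlgebra k Γ) := fun g v =>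
    (MonoidAlgebra.single g 1 : MonoidAlgebra k Γ) • v
  have hact_add : ∀ g u v, act g (u + v) = act g u + act g v := fun g u v => smul_add _ _ _
  have hact_sub : ∀ g u v, act g (u - v) = act g u - act g v := fun g u v => smul_sub _ _ _
  have hact_mul : ∀ g h v, act (g * h) v = act g (act h v) := fun g h v =>
    (single_smul_single_smul g h v).symm
  have hDact : ∀ e e', D (e * e') = D e + act (q (ρ e)) (D e') := hD
  let δ : B → (S →₀ MonoidAlgebra k Γ) := fun g => D (σ g)
  let θ : B → B → (S →₀ MonoidAlgebra k Γ) := fun g h => δ g + act (q g) (δ h) - δ (g * h)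
  have hDδ : ∀ e, D e - δ (ρ e) ∈ LinearMap.range bd := fun e =>
    foxDerivation_sub_mem_range hker (hσ (ρ e)).symm
  have hθ : ∀ g h, θ g h ∈ LinearMap.range bd := by
    intro g h
    have h1 : θ g h = D (σ g * σ h) - D (σ (g * h)) := by
      simp only [θ, δ]
      rw [hDact, hσ]
    rw [h1]
    exact foxDerivation_sub_mem_range hker (by rw [map_mul, hσ, hσ, hσ])
  -- the augmentation submodule of the image of `bd`
  let U : Submodule k (S →₀ MonoidAlgebra k Γ) :=
    (LinearMap.ker (augVec k Γ R)).map (bd.restrictScalars k)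
  have hU : ∀ g, ∀ v ∈ LinearMap.range bd, act g v - v ∈ U := by
    rintro g _ ⟨p, rfl⟩
    refine ⟨(MonoidAlgebra.single g 1 : MonoidAlgebra k Γ) • p - p, ?_, ?_⟩
    · rw [SetLike.mem_coe, LinearMap.mem_ker, map_sub, augVec_smul, aug_single, one_smul, sub_self]
    · rw [LinearMap.restrictScalars_apply, map_sub, map_smul]
  let Θ : (B × B →₀ k) →ₗ[k] ((S →₀ MonoidAlgebra k Γ) ⧸ U) :=
    Finsupp.linearCombination k fun g => U.mkQ (θ g.1 g.2)
  have hΘ : ∀ g h a, Θ (Finsupp.single (g, h) a) = a • U.mkQ (θ g h) := fun g h a => by simp [Θ]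
  have hΘbd : ∀ y, Θ (bar₃ k B y) = 0 := by
    intro y
    induction y using Finsupp.induction_linear with
    | zero => simp
    | add x y hx hy => simp only [map_add, hx, hy, add_zero]
    | single g a =>
      obtain ⟨g, h, j⟩ := g
      rw [bar₃_single, map_sub, map_add, map_sub, hΘ, hΘ, hΘ, hΘ, ← smul_sub, ← smul_add,
        ← smul_sub, ← map_sub, ← map_add, ← map_sub]
      convert smul_zero a
      rw [Submodule.mkQ_apply, Submodule.Quotient.mk_eq_zero]
      have h1 : θ h j - θ (g * h) j + θ g (h * j) - θ g h = -(act (q g) (θ h j) - θ h j) := by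
        simp only [θ, map_mul, hact_mul, hact_add, hact_sub, mul_assoc]
        abel
      rw [h1]
      exact neg_mem (hU _ _ (hθ h j))
  have hΘcyc : ∀ z, bar₂ k q.ker z = 0 → Θ (z.mapDomain (Prod.map (↑) (↑))) = 0 := by
    have h1 : ∀ z, Θ (z.mapDomain (Prod.map (↑) (↑))) =
        Finsupp.linearCombination k (fun n : q.ker => U.mkQ (δ n)) (bar₂ k q.ker z) := by
      intro z
      induction z using Finsupp.induction_linear with
      | zero => simp
      | add x y hx hy => simp only [map_add, Finsupp.mapDomain_add, hx, hy]
      | single g a =>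
        obtain ⟨g, h⟩ := g
        have h2 : Finsupp.linearCombination k (fun n : q.ker => U.mkQ (δ n))
            (bar₂ k q.ker (Finsupp.single (g, h) a)) =
            a • U.mkQ (δ h - δ (g * h : q.ker) + δ g) := by
          rw [bar₂_single, map_add, map_sub, Finsupp.linearCombination_single,
            Finsupp.linearCombination_single, Finsupp.linearCombination_single, ← smul_sub,
            ← smul_add, ← map_sub, ← map_add]
        rw [Finsupp.mapDomain_single, Prod.map_apply, hΘ, h2]
        congr 2
        have hg : act (q g) (δ h) = δ h := by
          rw [q.mem_ker.1 g.2]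
          exact single_one_smul _
        simp only [θ, hg, Subgroup.coe_mul]
        abel
    intro z hz
    rw [h1, hz, map_zero]
  -- the additive function `e ↦ (D e - δ (ρ e), [ρ e])`
  let T : (B × B →₀ k) →ₗ[k] (((S →₀ MonoidAlgebra k Γ) ⧸ U) × (B →₀ k)) := Θ.prod (-bar₂ k B)
  have hT : ∀ y, T y = (Θ y, -bar₂ k B y) := fun _ => rfl
  let mk := (LinearMap.range T).mkQ
  have hmkT : ∀ y, mk (T y) = 0 := fun y =>
    (Submodule.Quotient.mk_eq_zero _).2 ⟨y, rfl⟩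
  let χ : E → ((((S →₀ MonoidAlgebra k Γ) ⧸ U) × (B →₀ k)) ⧸ LinearMap.range T) := fun e =>
    mk (U.mkQ (D e - δ (ρ e)), Finsupp.single (ρ e) 1)
  have hχ : ∀ e e', χ (e * e') = χ e + χ e' := by
    intro e e'
    rw [← sub_eq_zero, ← sub_sub, ← hmkT (Finsupp.single (ρ e, ρ e') 1)]
    simp only [χ]
    rw [← map_sub, ← map_sub]
    congr 1
    refine Prod.ext ?_ ?_
    · simp only [Prod.fst_sub, hT, hΘ, one_smul, map_mul]
      rw [← map_sub, ← map_sub, ← sub_eq_zero, ← map_sub, Submodule.mkQ_apply,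
        Submodule.Quotient.mk_eq_zero]
      have h1 : D (e * e') - δ (ρ e * ρ e') - (D e - δ (ρ e)) - (D e' - δ (ρ e')) -
          θ (ρ e) (ρ e') = act (q (ρ e)) (D e' - δ (ρ e')) - (D e' - δ (ρ e')) := by
        simp only [θ, hDact, hact_sub]
        abel
      rw [h1]
      exact hU _ _ (hDδ e')
    · simp only [Prod.snd_sub, hT, bar₂_single, map_mul]
      abel
  let L : (S →₀ k) →ₗ[k] ((((S →₀ MonoidAlgebra k Γ) ⧸ U) × (B →₀ k)) ⧸ LinearMap.range T) :=
    Finsupp.linearCombination k fun s => χ (b s)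
  have hL : ∀ e, χ e = L (augVec k Γ S (D e)) := by
    refine freeGroupBasis_ext_add b hχ (fun e e' => ?_) fun s => ?_
    · rw [hDdef, augVec_foxDerivation_mul, map_add]
    · simp [L, hDdef, MonoidAlgebra.one_def]
  have hrel : ∀ r, χ (rel r) = mk (U.mkQ (D (rel r)), 0) := by
    intro r
    rw [← sub_eq_zero, ← neg_eq_zero, ← hmkT (Finsupp.single (1, 1) 1)]
    simp only [χ]
    rw [← map_sub, ← map_neg, rho_rel hker]
    congr 1
    have h1 : θ 1 1 = δ 1 := by
      simp only [θ, mul_one, map_one]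
      rw [show act 1 (δ 1) = δ 1 from single_one_smul _, add_sub_cancel_right]
    refine Prod.ext ?_ ?_
    · simp [hT, hΘ, h1]
    · simp [hT, bar₂_single]
  -- the constant lift of the augmentation of `p`
  let c : R →₀ MonoidAlgebra k Γ :=
    Finsupp.mapRange (algebraMap k (MonoidAlgebra k Γ)) (map_zero _) (augVec k Γ R p)
  have hc : augVec k Γ R c = augVec k Γ R p := by
    ext
    simp [c]
  have hbdc : bd c = Finsupp.linearCombination k (fun r => D (rel r)) (augVec k Γ R p) := by
    simp only [c, hbd, relatorMap, ← hDdef]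
    induction augVec k Γ R p using Finsupp.induction_linear with
    | zero => simp
    | add x y hx hy => rw [Finsupp.mapRange_add (fun a b => map_add _ a b), map_add, map_add, hx, hy]
    | single r a =>
      rw [Finsupp.mapRange_single, Finsupp.linearCombination_single,
        Finsupp.linearCombination_single, algebraMap_smul]
  have hzero : mk (U.mkQ (bd c), 0) = 0 := by
    have h1 : L (augVec k Γ S (bd p)) = mk (U.mkQ (bd c), 0) := by
      have h2 : augVec k Γ S (bd p) = Finsupp.linearCombination k
          (fun r => augVec k Γ S (D (rel r))) (augVec k Γ R p) := augVec_linearCombination _ _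
      rw [h2, hbdc, Finsupp.apply_linearCombination, Finsupp.apply_linearCombination]
      have h3 : (L ∘ fun r => augVec k Γ S (D (rel r))) =
          (mk ∘ₗ LinearMap.inl k _ _) ∘ (U.mkQ ∘ fun r => D (rel r)) := by
        funext r
        rw [Function.comp_apply, ← hL, hrel]
        rfl
      rw [h3, ← Finsupp.apply_linearCombination]
      rfl
    rw [← h1, hp, map_zero]
  obtain ⟨ζ, hζ⟩ := (Submodule.Quotient.mk_eq_zero _).1 hzero
  have hζ1 : Θ ζ = U.mkQ (bd c) := congrArg Prod.fst hζ
  have hζ2 : -bar₂ k B ζ = 0 := congrArg Prod.snd hζ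
  rw [hcycles Θ hΘbd hΘcyc ζ (neg_eq_zero.1 hζ2)] at hζ1
  obtain ⟨v, hv, hvc⟩ := (Submodule.Quotient.mk_eq_zero _).1 hζ1.symm
  refine ⟨c - v, ?_, ?_⟩
  · rw [map_sub, sub_eq_zero]
    exact hvc.symm
  · rw [map_sub, LinearMap.mem_ker.1 hv, sub_zero, hc]

end Presentation

/-! ### Torsion over the group ring -/

section Involution

variable {R Γ : Type*} [CommRing R] [Group Γ]

/-- The anti-involution of `R[Γ]` induced by inversion in `Γ`. It exchanges right modules, such as
`N / [N, N]`, and left modules, such as those of Fox derivatives. -/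
noncomputable def invol : MonoidAlgebra R Γ →+ MonoidAlgebra R Γ where
  toFun a := .ofCoeff (a.coeff.mapDomain (·⁻¹))
  map_zero' := by simp
  map_add' a b := by simp [Finsupp.mapDomain_add]

@[simp]
theorem invol_single (g : Γ) (c : R) :
    invol (MonoidAlgebra.single g c) = MonoidAlgebra.single g⁻¹ c := by
  simp [invol]

@[simp]
theorem invol_invol (a : MonoidAlgebra R Γ) : invol (invol a) = a := by
  induction a using MonoidAlgebra.induction_linear with
  | zero => simp
  | add x y hx hy => simp only [map_add, hx, hy]
  | single g c => simp

theorem invol_mul (a b : MonoidAlgebra R Γ) : invol (a * b) = invol b * invol a := by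
  induction a using MonoidAlgebra.induction_linear with
  | zero => simp
  | add x y hx hy => simp only [map_add, add_mul, mul_add, hx, hy]
  | single g c =>
    induction b using MonoidAlgebra.induction_linear with
    | zero => simp
    | add x y hx hy => simp only [map_add, add_mul, mul_add, hx, hy]
    | single h d => simp [MonoidAlgebra.single_mul_single, mul_comm]

theorem invol_ne_zero {a : MonoidAlgebra R Γ} (ha : a ≠ 0) : invol a ≠ 0 := fun h =>
  ha (by rw [← invol_invol a, h, map_zero])

/-- The right Ore condition for the group ring of a solvable group with unique products. -/
theorem exists_mul_eq_mul [IsDomain R] [Group.IsSolvable Γ] [UniqueProds Γ]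
    {γ δ : MonoidAlgebra R Γ} (hγ : γ ≠ 0) (hδ : δ ≠ 0) :
    ∃ p q, γ * p = δ * q ∧ γ * p ≠ 0 := by
  have := strongRankCondition_of_isSolvable R Γ
  let f : (Fin 2 → MonoidAlgebra R Γ) →ₗ[MonoidAlgebra R Γ] (Fin 1 → MonoidAlgebra R Γ) :=
    { toFun := fun x _ => x 0 * invol γ + x 1 * invol δ
      map_add' := fun x y => by
        ext1
        simp only [Pi.add_apply, add_mul]
        abel
      map_smul' := fun r x => by
        ext1
        simp [mul_add, mul_assoc] }
  have hf : ¬ Function.Injective f := fun h => by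
    have := le_of_fin_injective _ f h
    omega
  rw [← LinearMap.ker_eq_bot, LinearMap.ker_eq_bot'] at hf
  push Not at hf
  obtain ⟨x, hx, hx0⟩ := hf
  have h0 : x 0 * invol γ + x 1 * invol δ = 0 := congrFun hx 0
  have h1 : γ * invol (x 0) + δ * invol (x 1) = 0 := by
    have := congrArg invol h0
    rwa [map_add, invol_mul, invol_mul, invol_invol, invol_invol, map_zero] at this
  refine ⟨invol (x 0), -invol (x 1), ?_, fun h => hx0 ?_⟩
  · rw [mul_neg]
    exact eq_neg_of_add_eq_zero_left h1
  · rw [h, zero_add] at h1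
    have e0 := (mul_eq_zero.1 h).resolve_left hγ
    have e1 := (mul_eq_zero.1 h1).resolve_left hδ
    ext1 i
    fin_cases i
    · exact by_contra fun h => invol_ne_zero h e0
    · exact by_contra fun h => invol_ne_zero h e1

end Involution

/-! ### The torsion-free derived series -/

open scoped commutatorElement

section TorsionStep

variable {G : Type u} [Group G] (N : Subgroup G) [N.Normal]

theorem moduleAction_add_left (γ δ : MonoidAlgebra ℤ (G ⧸ N)) (v : Additive (Abelianization N)) :
    moduleAction N (γ + δ) v = moduleAction N γ v + moduleAction N δ v := by
  rw [moduleAction, map_add]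
  rfl

theorem moduleAction_zero_left (v : Additive (Abelianization N)) : moduleAction N 0 v = 0 := by
  rw [moduleAction, map_zero]
  rfl

theorem moduleAction_zsmul_left (n : ℤ) (γ : MonoidAlgebra ℤ (G ⧸ N))
    (v : Additive (Abelianization N)) : moduleAction N (n • γ) v = n • moduleAction N γ v := by
  rw [moduleAction, map_zsmul]
  rfl

theorem moduleAction_one (v : Additive (Abelianization N)) : moduleAction N 1 v = v := by
  rw [moduleAction, map_one]
  rfl

theorem torsionPreimage_subset : torsionPreimage N ⊆ N := fun _ h => h.1

theorem torsionStep_le : torsionStep N ≤ N := (Subgroup.closure_le N).2 (torsionPreimage_subset N)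

theorem commutator_le_torsionStep : ⁅N, N⁆ ≤ torsionStep N := by
  refine Subgroup.commutator_le.2 fun x hx y hy => Subgroup.subset_closure ?_
  refine ⟨Subgroup.commutator_le_left N N (Subgroup.commutator_mem_commutator hx hy), 1,
    one_ne_zero, ?_⟩
  rw [moduleAction_one]
  refine ofMul_eq_zero.2 ?_
  have : (⟨⁅x, y⁆, Subgroup.commutator_le_left N N (Subgroup.commutator_mem_commutator hx hy)⟩ : N) =
      ⁅(⟨x, hx⟩ : N), ⟨y, hy⟩⁆ := rfl
  rw [this, map_commutatorElement, commutatorElement_eq_one_iff_mul_comm, mul_comm]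

/-- By the Ore condition, the elements with torsion class already form a subgroup. -/
theorem mem_torsionStep_iff [UniqueProds (G ⧸ N)] [Group.IsSolvable (G ⧸ N)] {x : G} :
    x ∈ torsionStep N ↔ x ∈ torsionPreimage N := by
  refine ⟨fun hx => ?_, fun hx => Subgroup.subset_closure hx⟩
  let H : Subgroup G :=
    { carrier := torsionPreimage N
      one_mem' := ⟨one_mem N, 1, one_ne_zero, by
        rw [moduleAction_one]
        exact ofMul_eq_zero.2 (map_one _)⟩
      mul_mem' := by
        rintro x y ⟨hx, γ, hγ, hxγ⟩ ⟨hy, δ, hδ, hyδ⟩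
        obtain ⟨p, q, hpq, hp⟩ := exists_mul_eq_mul hγ hδ
        refine ⟨mul_mem hx hy, γ * p, hp, ?_⟩
        have : Additive.ofMul (Abelianization.of (⟨x * y, mul_mem hx hy⟩ : N)) =
            Additive.ofMul (Abelianization.of ⟨x, hx⟩) +
              Additive.ofMul (Abelianization.of ⟨y, hy⟩) := by
          rw [← ofMul_mul, ← map_mul]
          rfl
        rw [this, map_add]
        nth_rewrite 2 [hpq]
        rw [moduleAction_mul, moduleAction_mul, hxγ, hyδ, map_zero, map_zero, add_zero]
      inv_mem' := by
        rintro x ⟨hx, γ, hγ, hxγ⟩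
        refine ⟨inv_mem hx, γ, hγ, ?_⟩
        have : Additive.ofMul (Abelianization.of (⟨x⁻¹, inv_mem hx⟩ : N)) =
            -Additive.ofMul (Abelianization.of ⟨x, hx⟩) := by
          rw [← ofMul_inv, ← map_inv]
          rfl
        rw [this, map_neg, hxγ, neg_zero] }
  exact (Subgroup.closure_le H).2 (fun _ h => h) hx

/-- The kernel of `G / torsionStep N → G / N` is torsion-free abelian, as `N / [N, N]` modulo its
`ℤ[G / N]`-torsion has no `ℤ`-torsion. -/
theorem augReflecting_quotient_torsionStep {k : Type*} [Field k]
    (h : AugReflecting k (G ⧸ N)) : AugReflecting k (G ⧸ torsionStep N) := by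
  have := h.uniqueProds
  have := h.isSolvable
  let π : G ⧸ torsionStep N →* G ⧸ N :=
    QuotientGroup.map (torsionStep N) N (MonoidHom.id G) (torsionStep_le N)
  have hπ : ∀ g : G, π (g : G ⧸ torsionStep N) = (g : G ⧸ N) := fun g => rfl
  have hker : ∀ a : π.ker, ∃ x ∈ N, (a : G ⧸ torsionStep N) = (x : G ⧸ torsionStep N) := by
    rintro ⟨a, ha⟩
    obtain ⟨x, rfl⟩ := QuotientGroup.mk_surjective a
    exact ⟨x, (QuotientGroup.eq_one_iff x).1 ha, rfl⟩
  refine h.of_extension π (fun g => ?_) (fun a b => ?_) fun a n hn han => ?_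
  · obtain ⟨x, rfl⟩ := QuotientGroup.mk_surjective g
    exact ⟨x, hπ x⟩
  · obtain ⟨x, hx, hax⟩ := hker a
    obtain ⟨y, hy, hby⟩ := hker b
    rw [← commutatorElement_eq_one_iff_mul_comm]
    ext
    have : ((⁅a, b⁆ : π.ker) : G ⧸ torsionStep N) = ((⁅x, y⁆ : G) : G ⧸ torsionStep N) := by
      change ⁅(a : G ⧸ torsionStep N), (b : G ⧸ torsionStep N)⁆ = _
      rw [hax, hby]
      rfl
    rw [this, Subgroup.coe_one, QuotientGroup.eq_one_iff]
    exact commutator_le_torsionStep N (Subgroup.commutator_mem_commutator hx hy)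
  · obtain ⟨x, hx, hax⟩ := hker a
    ext
    rw [hax, Subgroup.coe_one, QuotientGroup.eq_one_iff, mem_torsionStep_iff]
    have hxn : x ^ n ∈ torsionPreimage N := by
      rw [← mem_torsionStep_iff, ← QuotientGroup.eq_one_iff, QuotientGroup.mk_pow, ← hax,
        ← Subgroup.coe_pow, han, Subgroup.coe_one]
    obtain ⟨hxN, γ, hγ, hxγ⟩ := hxn
    refine ⟨hx, (n : ℤ) • γ, ?_, ?_⟩
    · intro h0
      refine hγ ?_
      ext g
      have h1 : (n : ℤ) • γ.coeff g = 0 := congrArg (fun a => a.coeff g) h0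
      exact (smul_eq_zero.1 h1).resolve_left (by exact_mod_cast hn)
    · have : Additive.ofMul (Abelianization.of (⟨x ^ n, hxN⟩ : N)) =
          (n : ℤ) • Additive.ofMul (Abelianization.of ⟨x, hx⟩) := by
        rw [natCast_zsmul, ← ofMul_pow, ← map_pow]
        rfl
      rw [this, map_zsmul] at hxγ
      rw [moduleAction_zsmul_left, hxγ]

end TorsionStep

section Series

variable (G : Type u) [Group G]

instance torsionFreeDerivedSeries_normal (n : ℕ) : (torsionFreeDerivedSeries G n).Normal :=
  (torsionFreeDerivedAux G n).2

theorem torsionFreeDerivedSeries_antitone : Antitone (torsionFreeDerivedSeries G) :=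
  antitone_nat_of_succ_le fun n => torsionStep_le (torsionFreeDerivedSeries G n)

theorem derivedSeries_le_torsionFreeDerivedSeries (n : ℕ) :
    derivedSeries G n ≤ torsionFreeDerivedSeries G n := by
  induction n with
  | zero => exact le_top
  | succ n ih =>
    rw [derivedSeries_succ]
    exact (Subgroup.commutator_mono ih ih).trans
      (commutator_le_torsionStep (torsionFreeDerivedSeries G n))

theorem augReflecting_quotient_torsionFreeDerivedSeries (k : Type*) [Field k] (n : ℕ) :
    AugReflecting k (G ⧸ torsionFreeDerivedSeries G n) := by
  induction n with
  | zero =>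
    have : Subsingleton (G ⧸ torsionFreeDerivedSeries G 0) := QuotientGroup.subsingleton_quotient_top
    exact AugReflecting.of_subsingleton _
  | succ n ih => exact augReflecting_quotient_torsionStep (torsionFreeDerivedSeries G n) ih

end Series

/-! ### Torsion classes in the presentation complex -/

section Torsion

variable {k : Type u} [Field k] {E B : Type u} [Group E] [Group B] {R S : Type u}
  {b : FreeGroupBasis S E} {ρ : E →* B} {rel : R → E}

/-- If the class of `ρ e` in `N / [N, N]` is killed by `γ`, then the vector of Fox derivatives of
`e` is killed by the conjugate of `γ` in the cokernel of the matrix of Fox derivatives. -/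
theorem invol_smul_foxDerivation_mem_range
    (hker : Subgroup.normalClosure (Set.range rel) = ρ.ker) (hρ : Function.Surjective ρ)
    (N : Subgroup B) [N.Normal] {e : E} (he : ρ e ∈ N) (γ : MonoidAlgebra ℤ (B ⧸ N))
    (h : moduleAction N γ (Additive.ofMul (Abelianization.of ⟨ρ e, he⟩)) = 0) :
    MonoidAlgebra.mapRingHom (B ⧸ N) (Int.castRingHom k) (invol γ) •
      foxDerivation k b ((QuotientGroup.mk' N).comp ρ) e ∈
        LinearMap.range (relatorMap k b ρ rel (QuotientGroup.mk' N)) := by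
  set q := QuotientGroup.mk' N with hq
  set D := foxDerivation k b (q.comp ρ) with hDdef
  have hD : IsDerivation k (q.comp ρ) D := isDerivation_foxDerivation b (q.comp ρ)
  set M := LinearMap.range (relatorMap k b ρ rel q) with hM
  have hqN : ∀ {e}, ρ e ∈ N → q.comp ρ e = 1 := fun {e} h => (QuotientGroup.eq_one_iff _).2 h
  have hmk : ∀ {e e'}, ρ e = ρ e' → M.mkQ (D e) = M.mkQ (D e') := fun {e e'} h =>
    (Submodule.Quotient.eq M).2 (foxDerivation_sub_mem_range hker h)
  obtain ⟨σ, hσ⟩ := hρ.hasRightInverse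
  -- the homomorphism `N / [N, N] → coker` induced by the Fox derivation
  let t : N →* Multiplicative ((S →₀ MonoidAlgebra k (B ⧸ N)) ⧸ M) :=
    MonoidHom.mk' (fun x => Multiplicative.ofAdd (M.mkQ (D (σ x)))) fun x y => by
      rw [← ofAdd_add, ← map_add, ← hD.map_mul_of_mem (hqN (by rw [hσ]; exact x.2))]
      exact congrArg _ (hmk (by rw [map_mul, hσ, hσ, hσ]; rfl))
  let T : Additive (Abelianization N) →+ (S →₀ MonoidAlgebra k (B ⧸ N)) ⧸ M :=
    MonoidHom.toAdditiveLeft (Abelianization.lift t)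
  have hT : ∀ e (he : ρ e ∈ N), T (Additive.ofMul (Abelianization.of ⟨ρ e, he⟩)) = M.mkQ (D e) :=
    fun e he => hmk (hσ _)
  have key : ∀ (γ : MonoidAlgebra ℤ (B ⧸ N)) (v : Additive (Abelianization N)),
      T (moduleAction N γ v) =
        MonoidAlgebra.mapRingHom (B ⧸ N) (Int.castRingHom k) (invol γ) • T v := by
    intro γ v
    induction γ using MonoidAlgebra.induction_linear with
    | zero => simp [moduleAction_zero_left]
    | add x y hx hy => rw [moduleAction_add_left, map_add, hx, hy, map_add, map_add, add_smul]
    | single g n =>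
      obtain ⟨g, rfl⟩ := QuotientGroup.mk_surjective g
      obtain ⟨g, rfl⟩ := hρ g
      induction v using Additive.rec with | ofMul v =>
      obtain ⟨⟨x, hx⟩, rfl⟩ := QuotientGroup.mk_surjective v
      obtain ⟨e, rfl⟩ := hρ x
      have h1 : MonoidAlgebra.single ((ρ g : B) : B ⧸ N) n =
          n • MonoidAlgebra.of ℤ (B ⧸ N) ((ρ g : B) : B ⧸ N) := by
        simp [MonoidAlgebra.of]
      have h2 : MulAut.conjNormal (ρ g)⁻¹ (⟨ρ e, hx⟩ : N) = ⟨ρ (g⁻¹ * e * g⁻¹⁻¹), by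
          simp only [map_mul, map_inv]
          exact Subgroup.Normal.conj_mem inferInstance _ hx _⟩ := by
        ext
        simp
      have h3 := moduleAction_of N (ρ g) ⟨ρ e, hx⟩
      have h4 : MonoidAlgebra.mapRingHom (B ⧸ N) (Int.castRingHom k)
          (invol (MonoidAlgebra.single ((ρ g : B) : B ⧸ N) n)) =
          n • (MonoidAlgebra.single (q.comp ρ g⁻¹) 1 : MonoidAlgebra k (B ⧸ N)) := by
        simp [hq]
      have h5 : T (Additive.ofMul (Abelianization.of ⟨ρ e, hx⟩)) = M.mkQ (D e) := hT e hx
      rw [h4, smul_assoc, h1, moduleAction_zsmul_left, map_zsmul]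
      congr 1
      refine (congrArg T h3).trans ?_
      rw [h2, hT, hD.map_conj (hqN hx), map_smul]
      exact congrArg _ h5.symm
  have h6 := key γ (Additive.ofMul (Abelianization.of ⟨ρ e, he⟩))
  rw [h, map_zero, hT e he, ← map_smul] at h6
  exact (Submodule.Quotient.mk_eq_zero M).1 h6.symm

end Torsion

/-! ### Comparison of the derived series -/

instance : CharZero RatCoeff.{u} :=
  charZero_of_injective_ringHom (f := (ULift.ringEquiv (R := ℚ)).symm.toRingHom)
    (ULift.ringEquiv (R := ℚ)).symm.injective

/-- The inductive step: elements of a free group which become torsion in `N / [N, N]` have vanishing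
Fox derivatives, so they lie in the commutator subgroup of the preimage of `N`. -/
theorem comap_torsionStep_le {F B : Type u} [Group F] [Group B] [IsFreeGroup F]
    (hB : FinitelyRelated B) (φ : F →* B)
    (hφ : Function.Injective (trivialHomologyMap RatCoeff.{u} φ 1)) (N : Subgroup B) [N.Normal]
    (hN : AugReflecting RatCoeff.{u} (B ⧸ N)) {N' : Subgroup B} (hN' : N' ≤ N)
    (hsurf : H₂SpannedBySurfaces N') :
    (torsionStep N).comap φ ≤ ⁅N.comap φ, N.comap φ⁆ := by
  have := hN.uniqueProds
  have := hN.isSolvable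
  obtain ⟨S, rels, hfin, ⟨e⟩⟩ := hB
  let ρ : FreeGroup S →* B := e.toMonoidHom.comp (PresentedGroup.mk rels)
  have hρ : Function.Surjective ρ := e.surjective.comp (PresentedGroup.mk_surjective rels)
  let rel : rels → FreeGroup S := Subtype.val
  have hker : Subgroup.normalClosure (Set.range rel) = ρ.ker := by
    ext x
    rw [Subtype.range_coe, MonoidHom.mem_ker, ← PresentedGroup.mk_eq_one_iff]
    exact (map_eq_one_iff e e.injective).symm
  have : Finite rels := hfin
  let b := FreeGroupBasis.ofFreeGroup S
  let b' := IsFreeGroup.basis F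
  obtain ⟨σ, hσ⟩ := hρ.hasRightInverse
  let φ' : F →* FreeGroup S := b'.lift fun x => σ (φ (b' x))
  have hφ' : ρ.comp φ' = φ := b'.ext_hom _ _ fun x => by simp [φ', hσ _]
  let q := QuotientGroup.mk' N
  have hq : q.ker = N := QuotientGroup.ker_mk' N
  intro f hf
  obtain ⟨hfN, γ, hγ, hfγ⟩ := (mem_torsionStep_iff N).1 hf
  have hφf : ρ (φ' f) = φ f := DFunLike.congr_fun hφ' f
  have hmem : ρ (φ' f) ∈ N := hφf ▸ hfN
  obtain ⟨p, hp⟩ := invol_smul_foxDerivation_mem_range (k := RatCoeff.{u}) (b := b) hker hρ N hmem γ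
    (by convert hfγ)
  -- the coefficient of the torsion relation for `f`, acting from the left
  set c : MonoidAlgebra RatCoeff.{u} (B ⧸ N) :=
    MonoidAlgebra.mapRingHom (B ⧸ N) (Int.castRingHom RatCoeff.{u}) (invol γ) with hc
  have hc0 : c ≠ 0 := by
    intro h0
    refine invol_ne_zero hγ ?_
    ext g
    have := congrArg (fun a => a.coeff g) h0
    exact Int.cast_eq_zero (α := RatCoeff.{u}) |>.1 (by simpa [hc] using this)
  have hD := (isDerivation_foxDerivation (k := RatCoeff.{u}) b (q.comp ρ)).comp φ'
  rw [MonoidHom.comp_assoc, hφ'] at hD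
  have hlin := hD.eq_linearCombination b' (q.comp φ) f
  rw [Function.comp_apply] at hlin
  rw [hlin, ← map_smul] at hp
  have hzero := eq_zero_of_augVec hN (relatorMap RatCoeff.{u} b ρ rel q) _
    (fun p x h => augVec_eq_zero_of_injective hker b' hφ hφ' h)
    (fun p hp => exists_augVec_eq_of_surfaces hker hρ
      (fun Θ h₁ h₂ => hsurf.eq_zero_of_le (hN'.trans hq.ge) Θ h₁ h₂) p hp) hp
  have hfox : foxDerivation RatCoeff.{u} b' (q.comp φ) f = 0 :=
    (smul_eq_zero.1 hzero).resolve_left hc0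
  have hcomap : (q.comp φ).ker = N.comap φ := by rw [← MonoidHom.comap_ker, hq]
  rw [← hcomap]
  exact mem_commutator_ker_of_foxDerivation b' _ (by rw [hcomap]; exact hfN) hfox

/-- An element of the free group which `φ` maps into `B_H^{(m)}` lies in `F^{(m)}`. -/
theorem comap_torsionFreeDerivedSeries_le {F B : Type u} [Group F] [Group B] [IsFreeGroup F]
    (hB : FinitelyRelated B) (φ : F →* B)
    (hφ : Function.Injective (trivialHomologyMap RatCoeff.{u} φ 1)) {n : ℕ} {N : Subgroup B}
    (hN : N ≤ torsionFreeDerivedSeries B n) (hsurf : H₂SpannedBySurfaces N) :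
    ∀ m ≤ n + 1, (torsionFreeDerivedSeries B m).comap φ ≤ derivedSeries F m := by
  intro m
  induction m with
  | zero => exact fun _ => le_top
  | succ m ih =>
    intro hm
    have h := comap_torsionStep_le hB φ hφ (torsionFreeDerivedSeries B m)
      (augReflecting_quotient_torsionFreeDerivedSeries B RatCoeff.{u} m)
      (hN.trans (torsionFreeDerivedSeries_antitone B (Nat.le_of_succ_le_succ hm))) hsurf
    have ih' := ih (Nat.le_of_succ_le hm)
    exact h.trans (Subgroup.commutator_mono ih' ih')

end TorsionFreeDwyer

theorem corollary2p2 {F B : Type u} [Group F] [Group B] [IsFreeGroup F]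
    (hB : TorsionFreeDwyer.FinitelyRelated B) (φ : F →* B)
    (hφ : Function.Injective
      (TorsionFreeDwyer.trivialHomologyMap TorsionFreeDwyer.RatCoeff.{u} φ 1))
    (n : ℕ)
    (hsurf : TorsionFreeDwyer.H₂SpannedBySurfaces (derivedSeries B n) ∨
      TorsionFreeDwyer.H₂SpannedBySurfaces (TorsionFreeDwyer.torsionFreeDerivedSeries B n)) :
    ∀ m ≤ n + 1, Function.Injective (TorsionFreeDwyer.derivedQuotientMap φ m) := by
  intro m hm
  have h : (TorsionFreeDwyer.torsionFreeDerivedSeries B m).comap φ ≤ derivedSeries F m :=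
    hsurf.elim
      (fun h => TorsionFreeDwyer.comap_torsionFreeDerivedSeries_le hB φ hφ
        (TorsionFreeDwyer.derivedSeries_le_torsionFreeDerivedSeries B n) h m hm)
      (fun h => TorsionFreeDwyer.comap_torsionFreeDerivedSeries_le hB φ hφ le_rfl h m hm)
  rw [injective_iff_map_eq_one]
  intro x hx
  obtain ⟨f, rfl⟩ := QuotientGroup.mk_surjective x
  have hf : φ f ∈ derivedSeries B m := (QuotientGroup.eq_one_iff _).1 hx
  exact (QuotientGroup.eq_one_iff _).2
    (h (TorsionFreeDwyer.derivedSeries_le_torsionFreeDerivedSeries B m hf))
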